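/- Let $h>0$, $T=Nh$ with $N\ge 1$ an integer, let $f,g:\mathbb R^n\times\mathbb R^n\to\mathbb R^n$ be bounded and of class $C^1$, and let $x_0,\xi_0\in\mathbb R^n$. Consider the impulsive system with delay $$\text{(DIS)}\qquad dx(t)=f(x(t),x(t-h))\,dt+g(x(t),x(t-h))\,d\mu(t),\quad t\in[0,T],\qquad x(0)=x_0,\quad x=\xi_0 \text{ on } [-h,0[ .$$ An *impulsive control* $(\mu,\{w^r\}_{r\in[0,h]})$ consists of a finite non-negative Borel measure $\mu$ on $[0,T]$ and measurable functions $w^r=(w^r_1,\dots,w^r_N):[0,1]\to[0,+\infty[^N$, $r\in[0,h]$, such that * for every $r\in[0,h]$, $\sum_{i=1}^N w^r_i(s)=\sum_{i=1}^N\int_0^1 w^r_i(s')\,ds'$ for a.e. $s\in[0,1]$; * for every $r\in\,]0,h[$ and $i=1,\dots,N$, $\int_0^1 w^r_i(s)\,ds=\mu(\{r+(i-1)h\})$; * for $i=0,\dots,N$, $\int_0^1[w^h_i(s)+w^0_{i+1}(s)]\,ds=\mu(\{ih\})$, where $w^h_0\equiv 0$ and $w^0_{N+1}\equiv 0$. A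 function $x\in BV([-h,T];\mathbb R^n)$ is an *extended state trajectory* of (DIS) associated with the impulsive control $(\mu,\{w^r\})$ if $x(t)=\xi_0$ for $t\in[-h,0[$ and there are functions $\zeta^r_i:[0,1]\to\mathbb R^n$ ($r\in[0,h]$, $i=0,\dots,N$) such that: * $\zeta^h_0(1)=x_0$, and $\zeta^r_0(s)=\xi_0$ if $s\in[0,1[$ or $r\in[0,h[$; * for $i=1,\dots,N$ and $r\in[0,h]$, $\zeta^r_i$ is absolutely continuous, $\frac{d}{ds}\zeta^r_i(s)=w^r_i(s)\,g(\zeta^r_i(s),\zeta^r_{i-1}(s))$ for a.e. $s\in[0,1]$, $\zeta^r_i(0)=x^-(r+(i-1)h)$ if $r\in\,]0,h]$, and $\zeta^0_i(0)=\zeta^h_{i-1}(1)$, where $x^-(t)$ is the left limit of $x$ at $t$; * $x(0)=x_0$, $x((i-1)h)=\zeta^0_i(1)$ for $i=2,\dots,N$, and $x(T)=\zeta^h_N(1)$; * for $i=1,\dots,N$ and $t\in\,](i-1)h,ih[$, $$x(t)=\zeta^0_i(1)+\int_{(i-1)h}^t f(x(t'),x(t'-h))\,dt'+\int_{[(i-1)h,t]}g(x(t'),x(t'-h))\,d\mu^c(t')+\sum_{r\in]0,t-(i-1)h]}\bigl(\zeta^r_i(1)-x^-(r+(i-1)h)\bigr),$$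 where the sum converges and $\mu^c$ is the continuous (atom-free) component of $\mu$. **Proposition.** For every impulsive control $(\mu,\{w^r\}_{r\in[0,h]})$ there exists an extended state trajectory $x\in BV([-h,T];\mathbb R^n)$ of (DIS) associated with it, and this trajectory is unique (as a function on $[-h,T]$). -/

import Mathlib

open Set MeasureTheory Filter Topology
open scoped ENNReal NNReal

namespace DIS

/-- The continuous (atom-free) component of a measure on the line: the part that
is left when all atoms are removed. -/
noncomputable def continuousPart (μ : Measure ℝ) : Measure ℝ :=
  μ.restrict {t : ℝ | μ {t} = 0}

/-- `(μ, {w^r}_{r ∈ [0,h]})` is an impulsive control on `[0, T]` with `N` components.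
A measure on `[0, T]` is a measure on the line that vanishes off `[0, T]`.
The component `w^r_i`, `1 ≤ i ≤ N`, of the attached control at `r ∈ [0,h]` is `w i r`; only its
values on `[0, 1]` matter, and "measurable" means Lebesgue measurable on `[0, 1]`.
Indices `1 ≤ i ≤ N` are written `i + 1` with `i < N`. -/
structure IsImpulsiveControl (h T : ℝ) (N : ℕ)
    (μ : Measure ℝ) (w : ℕ → ℝ → ℝ → ℝ≥0) : Prop where
  finite : IsFiniteMeasure μ
  supported : μ (Icc 0 T)ᶜ = 0
  measurable : ∀ r ∈ Icc 0 h, ∀ i < N,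
    AEMeasurable (w (i + 1) r) (volume.restrict (Icc 0 1))
  sum_eq : ∀ r ∈ Icc 0 h, ∀ᵐ s ∂(volume.restrict (Icc (0 : ℝ) 1)),
    ∑ i ∈ Finset.range N, (w (i + 1) r s : ℝ≥0∞)
      = ∑ i ∈ Finset.range N, ∫⁻ s' in Icc (0 : ℝ) 1, (w (i + 1) r s' : ℝ≥0∞)
  interior : ∀ r ∈ Ioo 0 h, ∀ i < N,
    ∫⁻ s in Icc (0 : ℝ) 1, (w (i + 1) r s : ℝ≥0∞) = μ {r + i * h}
  /-- Here `w^h_0` and `w^0_{N+1}` are read as `0`. -/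
  endpoint : ∀ i ≤ N,
    (if i = 0 then 0 else ∫⁻ s in Icc (0 : ℝ) 1, (w i h s : ℝ≥0∞))
      + (if i = N then 0 else ∫⁻ s in Icc (0 : ℝ) 1, (w (i + 1) 0 s : ℝ≥0∞)) = μ {i * h}

variable {n : ℕ}

/-- The functions `ζ^r_i = ζ i r : [0,1] → ℝⁿ`, `0 ≤ i ≤ N`, `r ∈ [0,h]`, are the jump arcs of `x`:
`ζ^r_0` is the prescribed one, and for `1 ≤ i ≤ N` (written `i + 1` with `i < N`) the functions are
absolutely continuous solutions of the coupled differential equations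
`dζ^r_i/ds = w^r_i g(ζ^r_i, ζ^r_{i-1})` a.e. on `[0,1]`, with `ζ^r_i(0) = x^-(r + (i-1)h)`
if `0 < r ≤ h` and `ζ^0_i(0) = ζ^h_{i-1}(1)`. -/
structure IsJumpArcs (h : ℝ) (N : ℕ)
    (g : EuclideanSpace ℝ (Fin n) × EuclideanSpace ℝ (Fin n) → EuclideanSpace ℝ (Fin n))
    (x₀ ξ₀ : EuclideanSpace ℝ (Fin n)) (w : ℕ → ℝ → ℝ → ℝ≥0)
    (x : ℝ → EuclideanSpace ℝ (Fin n))
    (ζ : ℕ → ℝ → ℝ → EuclideanSpace ℝ (Fin n)) : Prop where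
  zero_eq : ∀ r ∈ Icc 0 h, ∀ s ∈ Icc (0 : ℝ) 1,
    ζ 0 r s = if s = 1 ∧ r = h then x₀ else ξ₀
  absCont : ∀ i < N, ∀ r ∈ Icc 0 h, AbsolutelyContinuousOnInterval (ζ (i + 1) r) 0 1
  ode : ∀ i < N, ∀ r ∈ Icc 0 h, ∀ᵐ s ∂(volume.restrict (Icc (0 : ℝ) 1)),
    HasDerivAt (ζ (i + 1) r) ((w (i + 1) r s : ℝ) • g (ζ (i + 1) r s, ζ i r s)) s
  init_pos : ∀ i < N, ∀ r ∈ Ioc 0 h, ζ (i + 1) r 0 = Function.leftLim x (r + i * h)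
  init_zero : ∀ i < N, ζ (i + 1) 0 0 = ζ i h 1

/-- `(x, μ, {w^r}_{r ∈ [0,h]})` is an extended process, with extended state trajectory `x`, of the
impulsive delay system `dx(t) = f(x(t), x(t-h)) dt + g(x(t), x(t-h)) dμ(t)` on `[0, T]`, `x(0) = x₀`,
`x = ξ₀` on `[-h, 0)`. A function on `[-h, T]` is represented by a function on the line, of which
only the values on `[-h, T]` matter. -/
def IsExtendedProcess (h T : ℝ) (N : ℕ)
    (f g : EuclideanSpace ℝ (Fin n) × EuclideanSpace ℝ (Fin n) → EuclideanSpace ℝ (Fin n))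
    (x₀ ξ₀ : EuclideanSpace ℝ (Fin n)) (x : ℝ → EuclideanSpace ℝ (Fin n))
    (μ : Measure ℝ) (w : ℕ → ℝ → ℝ → ℝ≥0) : Prop :=
  IsImpulsiveControl h T N μ w ∧
  BoundedVariationOn x (Icc (-h) T) ∧
  (∀ t ∈ Ico (-h) 0, x t = ξ₀) ∧
  ∃ ζ : ℕ → ℝ → ℝ → EuclideanSpace ℝ (Fin n),
    IsJumpArcs h N g x₀ ξ₀ w x ζ ∧
    x 0 = x₀ ∧
    (∀ i < N, 0 < i → x (i * h) = ζ (i + 1) 0 1) ∧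
    (∀ i < N, ∀ t ∈ Ioo (i * h) ((i + 1) * h),
      Summable (fun r : Ioc 0 (t - i * h) =>
        ζ (i + 1) r 1 - Function.leftLim x (r + i * h)) ∧
      x t = ζ (i + 1) 0 1
        + (∫ t' in (i * h)..t, f (x t', x (t' - h)))
        + (∫ t' in Icc (i * h) t, g (x t', x (t' - h)) ∂(continuousPart μ))
        + ∑' r : Ioc 0 (t - i * h), (ζ (i + 1) r 1 - Function.leftLim x (r + i * h))) ∧
    x T = ζ N h 1

end DIS

namespace DIS

/-! On each interval `(ih, (i+1)h)` the delayed trajectory and the delayed jump arcs are already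
known, so induction on `i` reduces everything to one step without delay. In a step the right unknown
is the left limit `u = x^-`. The jump at `t` is a function of `u t`, and `x = u` off a countable set
of atoms, hence almost everywhere for Lebesgue measure and for `μ^c`. The equation becomes a
Volterra equation `u t = c + I u (Iio t)`, where `c` is the endpoint of the arc at `r = 0`, and `x t
= c + I u (Iic t)` recovers the trajectory.

For bounded `u`, `v` the operator satisfies `‖I u S - I v S‖ ≤ L ∫_S ‖u - v‖ dν` with a finite `ν`
that may have atoms. Since only the strict past enters, the atoms need not be small: `W t = exp
((2L+1) ν (Iio t))` satisfies `L ∫_{s<t} W dν ≤ W t / 2` (`lintegral_expWeight_le`). This gives a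
Gronwall inequality (`le_of_le_add_lintegral`) and geometric convergence of Picard iteration
(`IsDriver.exists_solution`). Boundedness of `f` and `g` bounds all solutions a priori, so Lipschitz
constants on balls suffice.

Jump arcs fall under the same theory, with `ν = ω ds` on `[0,1]`. Their continuous dependence makes
the jump a Lipschitz function of the left limit, with constant proportional to the mass of the atom
(`IsArcData.jump_lipschitz`), so the sum of the jumps is itself an admissible operator for `μ`.
`IsStep.exists_leftLim_solution` translates a step into the Volterra equation;
`IsStepData.exists_step` and `IsStep.unique` solve it. For the glued function,
`IsStep.exists_bounds` dominates the oscillation on each open interval by a monotone function, and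
finitely many bounded jumps at grid points are added. -/

/-! ### Gronwall's inequality for finite measures with atoms. -/

theorem measure_superlevel_le (ν : Measure ℝ) [IsFiniteMeasure ν] (t τ : ℝ) :
    ν (Iio t ∩ {s | τ < ν.real (Iio s)}) ≤ ENNReal.ofReal (ν.real (Iio t) - τ) := by
  have hmono : Monotone fun s => ν.real (Iio s) := fun a b hab =>
    measureReal_mono (Iio_subset_Iio hab)
  have hmeas : MeasurableSet (Iio t ∩ {s | τ < ν.real (Iio s)}) :=
    measurableSet_Iio.inter (measurableSet_lt measurable_const hmono.measurable)
  refine le_of_forall_lt fun r hr => ?_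
  obtain ⟨K, hKS, hK, hrK⟩ := hmeas.exists_lt_isCompact_of_ne_top (measure_ne_top _ _) hr
  refine hrK.trans_le ?_
  rcases K.eq_empty_or_nonempty with rfl | hne
  · simp
  -- The minimum of `K` lies in the superlevel set, and `K` is contained in `[min K, t)`, whose mass
  -- is `ν (Iio t) - ν (Iio (min K))`. Passing to compact subsets avoids deciding whether the
  -- superlevel ray contains its endpoint.
  have hm := hK.sInf_mem hne
  have hsub : K ⊆ Ico (sInf K) t := fun x hx => ⟨csInf_le hK.bddBelow hx, (hKS hx).1⟩
  refine (measure_mono hsub).trans ?_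
  rw [← Iio_sdiff_Iio, measure_sdiff (Iio_subset_Iio (hKS hm).1.le)
    measurableSet_Iio.nullMeasurableSet (measure_ne_top _ _),
    ← ofReal_measureReal, ← ofReal_measureReal, ← ENNReal.ofReal_sub _ measureReal_nonneg]
  have h := (hKS hm).2
  simp only [mem_ofPred_eq] at h
  exact ENNReal.ofReal_le_ofReal (by linarith)

theorem integral_sub_mul_exp (K A : ℝ) (hK : 0 < K) :
    ∫ τ in (0 : ℝ)..A, (A - τ) * (K * Real.exp (K * τ)) = (Real.exp (K * A) - 1) / K - A := by
  have hd : ∀ τ ∈ uIcc 0 A, HasDerivAt (fun τ => (A - τ) * Real.exp (K * τ) + Real.exp (K * τ) / K)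
      ((A - τ) * (K * Real.exp (K * τ))) τ := by
    intro τ _
    have h1 : HasDerivAt (fun τ => Real.exp (K * τ)) (Real.exp (K * τ) * (K * 1)) τ :=
      ((hasDerivAt_id τ).const_mul K).exp
    have h2 : HasDerivAt (fun τ => A - τ) (-1) τ := by simpa using (hasDerivAt_id τ).const_sub A
    convert! (h2.mul h1).add (h1.div_const K) using 1
    field_simp
    ring
  rw [intervalIntegral.integral_eq_sub_of_hasDerivAt hd
    (Continuous.intervalIntegrable (by fun_prop) _ _)]
  simp
  field_simp
  ring

/-- By the layer-cake formula and `measure_superlevel_le`, the integral is at most what an atomless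
measure would give, `∫ exp (K τ) dτ` over `[0, ν (Iio t)]`. An atom only helps, because the
integrand sees the mass strictly before it. -/
theorem lintegral_exp_measure_Iio_le (ν : Measure ℝ) [IsFiniteMeasure ν] (K : ℝ) (hK : 0 < K)
    (t : ℝ) :
    ∫⁻ s in Iio t, ENNReal.ofReal (Real.exp (K * ν.real (Iio s))) ∂ν
      ≤ ENNReal.ofReal (Real.exp (K * ν.real (Iio t)) / K) := by
  set A := fun s => ν.real (Iio s) with hA
  have hmono : Monotone A := fun a b hab => measureReal_mono (Iio_subset_Iio hab)
  have hA0 : ∀ s, 0 ≤ A s := fun s => measureReal_nonneg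
  have hint : ∀ x, ∫ τ in (0 : ℝ)..x, K * Real.exp (K * τ) = Real.exp (K * x) - 1 := by
    intro x
    have hd : ∀ τ ∈ uIcc 0 x, HasDerivAt (fun τ => Real.exp (K * τ)) (K * Real.exp (K * τ)) τ := by
      intro τ _
      convert! ((hasDerivAt_id τ).const_mul K).exp using 1
      simp [mul_comm]
    rw [intervalIntegral.integral_eq_sub_of_hasDerivAt hd
      (Continuous.intervalIntegrable (by fun_prop) _ _)]
    simp
  have hlc := lintegral_comp_eq_lintegral_meas_lt_mul (ν.restrict (Iio t)) (f := A)
    (g := fun τ => K * Real.exp (K * τ)) (ae_of_all _ hA0) hmono.measurable.aemeasurable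
    (fun x _ => Continuous.intervalIntegrable (by fun_prop) _ _)
    (ae_of_all _ fun τ => by positivity)
  have h1 : ∀ s, ENNReal.ofReal (Real.exp (K * A s))
      = 1 + ENNReal.ofReal (∫ τ in (0 : ℝ)..A s, K * Real.exp (K * τ)) := by
    intro s
    rw [hint, ← ENNReal.ofReal_one, ← ENNReal.ofReal_add zero_le_one]
    · simp
    · have := Real.one_le_exp (mul_nonneg hK.le (hA0 s)); linarith
  have h2 : ∫⁻ τ in Ioi (0 : ℝ), ν.restrict (Iio t) {s | τ < A s} *
        ENNReal.ofReal (K * Real.exp (K * τ))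
      ≤ ENNReal.ofReal (∫ τ in (0 : ℝ)..A t, (A t - τ) * (K * Real.exp (K * τ))) := by
    rw [intervalIntegral.integral_of_le (hA0 t), ofReal_integral_eq_lintegral_ofReal]
    rotate_left
    · exact (Continuous.intervalIntegrable (by fun_prop) 0 (A t)).1
    · refine (ae_restrict_iff' measurableSet_Ioc).2 (ae_of_all _ fun τ hτ => ?_)
      have := hτ.2
      have : 0 ≤ A t - τ := by linarith
      simp only [Pi.zero_apply]; positivity
    · rw [← lintegral_indicator measurableSet_Ioc, ← lintegral_indicator measurableSet_Ioi]
      refine lintegral_mono fun τ => ?_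
      by_cases h0 : 0 < τ
      · have hb := measure_superlevel_le ν t τ
        rw [indicator_of_mem (show τ ∈ Ioi 0 from h0),
          Measure.restrict_apply (measurableSet_lt measurable_const hmono.measurable), inter_comm]
        by_cases h3 : τ ≤ A t
        · rw [indicator_of_mem (show τ ∈ Ioc 0 (A t) from ⟨h0, h3⟩),
            ENNReal.ofReal_mul (p := A t - τ) (by linarith)]
          exact mul_le_mul_left hb _
        · have : ENNReal.ofReal (A t - τ) = 0 := ENNReal.ofReal_of_nonpos (by linarith)
          have hz : ν (Iio t ∩ {s | τ < A s}) = 0 := le_antisymm (hb.trans this.le) bot_le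
          simp [hz]
      · simp [h0]
  rw [lintegral_congr h1, lintegral_add_left measurable_const, hlc]
  refine (add_le_add_right h2 _).trans ?_
  rw [integral_sub_mul_exp K (A t) hK, lintegral_const, one_mul, Measure.restrict_apply_univ,
    ← ofReal_measureReal]
  have h4 : 0 ≤ (Real.exp (K * A t) - 1) / K - A t := by
    have := Real.add_one_le_exp (K * A t)
    rw [sub_nonneg, le_div_iff₀ hK]; linarith
  rw [← ENNReal.ofReal_add measureReal_nonneg h4]
  refine ENNReal.ofReal_le_ofReal ?_
  have : 0 ≤ 1 / K := by positivity
  simp only [hA, sub_div] at *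
  linarith

/-- The exponential weight attached to a finite measure and a Lipschitz constant. -/
noncomputable def expWeight (ν : Measure ℝ) (L : ℝ≥0) (t : ℝ) : ℝ≥0∞ :=
  ENNReal.ofReal (Real.exp ((2 * L + 1) * ν.real (Iio t)))

theorem one_le_expWeight (ν : Measure ℝ) (L : ℝ≥0) (t : ℝ) : 1 ≤ expWeight ν L t := by
  rw [expWeight, ← ENNReal.ofReal_one]
  exact ENNReal.ofReal_le_ofReal (Real.one_le_exp (by positivity))

theorem expWeight_ne_top (ν : Measure ℝ) (L : ℝ≥0) (t : ℝ) : expWeight ν L t ≠ ∞ :=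
  ENNReal.ofReal_ne_top

theorem expWeight_le (ν : Measure ℝ) [IsFiniteMeasure ν] (L : ℝ≥0) (t m : ℝ)
    (hm : ν.real univ ≤ m) :
    expWeight ν L t ≤ ENNReal.ofReal (Real.exp ((2 * L + 1) * m)) := by
  refine ENNReal.ofReal_le_ofReal (Real.exp_le_exp.2 ?_)
  have : ν.real (Iio t) ≤ m := (measureReal_mono (subset_univ _)).trans hm
  gcongr

/-- The rate `2L + 1` is positive even for `L = 0` and satisfies `L / (2L + 1) ≤ 1/2`; this is the
contraction factor used everywhere below. -/
theorem lintegral_expWeight_le (ν : Measure ℝ) [IsFiniteMeasure ν] (L : ℝ≥0) (t : ℝ) :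
    L * ∫⁻ s in Iio t, expWeight ν L s ∂ν ≤ expWeight ν L t / 2 := by
  have hK : (0 : ℝ) < 2 * L + 1 := by positivity
  have h := lintegral_exp_measure_Iio_le ν (2 * L + 1) hK t
  refine (mul_le_mul_right h _).trans ?_
  rw [expWeight, ← ENNReal.ofReal_coe_nnreal, ← ENNReal.ofReal_mul L.coe_nonneg,
    ← ENNReal.ofReal_ofNat 2, ← ENNReal.ofReal_div_of_pos two_pos]
  refine ENNReal.ofReal_le_ofReal ?_
  rw [← mul_div_assoc, div_le_div_iff₀ hK two_pos]
  nlinarith [Real.exp_pos ((2 * L + 1) * ν.real (Iio t))]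

/-- Substituting a bound `(2δ + b) W` into the hypothesis improves it to `(2δ + b/2) W`. The a
priori bound `B` starts the iteration. -/
theorem le_of_le_add_lintegral (ν : Measure ℝ) [IsFiniteMeasure ν] (L : ℝ≥0) {φ : ℝ → ℝ≥0∞}
    {δ B : ℝ≥0∞} (hB : B ≠ ∞) (hφB : ∀ t, φ t ≤ B)
    (h : ∀ t, φ t ≤ δ + L * ∫⁻ s in Iio t, φ s ∂ν) (t : ℝ) : φ t ≤ 2 * δ * expWeight ν L t := by
  have key : ∀ k : ℕ, ∀ t, φ t ≤ (2 * δ + B / 2 ^ k) * expWeight ν L t := by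
    intro k
    induction k with
    | zero =>
      intro t
      calc φ t ≤ B * 1 := by simpa using hφB t
        _ ≤ (2 * δ + B / 2 ^ 0) * expWeight ν L t := by
          gcongr
          · simp
          · exact one_le_expWeight ν L t
    | succ k ih =>
      intro t
      calc φ t ≤ δ + L * ∫⁻ s in Iio t, φ s ∂ν := h t
        _ ≤ δ + L * ∫⁻ s in Iio t, (2 * δ + B / 2 ^ k) * expWeight ν L s ∂ν := by
          gcongr with s; exact ih s
        _ ≤ δ + (2 * δ + B / 2 ^ k) * (L * ∫⁻ s in Iio t, expWeight ν L s ∂ν) := by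
          by_cases hδ : δ = ∞
          · simp [hδ]
          rw [lintegral_const_mul' _ _ (by finiteness)]
          apply le_of_eq; ring
        _ ≤ δ * expWeight ν L t + (2 * δ + B / 2 ^ k) * (expWeight ν L t / 2) := by
          gcongr
          · exact le_mul_of_one_le_right bot_le (one_le_expWeight ν L t)
          · exact lintegral_expWeight_le ν L t
        _ = (2 * δ + B / 2 ^ (k + 1)) * expWeight ν L t := by
          simp only [div_eq_mul_inv, pow_succ, ENNReal.mul_inv (Or.inr ENNReal.ofNat_ne_top)
            (Or.inr two_ne_zero)]
          have : (2 : ℝ≥0∞) * 2⁻¹ = 1 := ENNReal.mul_inv_cancel two_ne_zero ENNReal.ofNat_ne_top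
          calc _ = δ * expWeight ν L t + δ * expWeight ν L t * (2 * 2⁻¹)
                + B * (2 ^ k)⁻¹ * 2⁻¹ * expWeight ν L t := by ring
            _ = _ := by rw [this]; ring
  have hlim : Tendsto (fun k : ℕ => (2 * δ + B / 2 ^ k) * expWeight ν L t) atTop
      (𝓝 ((2 * δ + 0) * expWeight ν L t)) := by
    refine ENNReal.Tendsto.mul_const (tendsto_const_nhds.add ?_) (Or.inr (expWeight_ne_top ν L t))
    have h2 := ENNReal.Tendsto.const_mul (a := B) (ENNReal.tendsto_pow_atTop_nhds_zero_of_lt_one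
      (r := 2⁻¹) (by simp)) (Or.inr hB)
    simpa [div_eq_mul_inv, ENNReal.inv_pow] using h2
  simpa using ge_of_tendsto' hlim fun k => key k t

/-! ### Volterra equations driven by a finite measure. -/

section Volterra

variable {E : Type*} [NormedAddCommGroup E]

/-- The function `u` is constant on the fibres of `A`, so it factors through a Lipschitz map on the
separable space `range A`. No separability of `E` is needed. -/
theorem stronglyMeasurable_of_edist_le {A : ℝ → ℝ} (hA : Measurable A) {C : ℝ≥0} {u : ℝ → E}
    (hu : ∀ s t, edist (u s) (u t) ≤ C * edist (A s) (A t)) : StronglyMeasurable u := by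
  choose σ hσ using fun x : range A => x.2
  have hfac : u = (fun x => u (σ x)) ∘ rangeFactorization A := by
    funext t
    have h : A (σ (rangeFactorization A t)) = A t := hσ _
    have := hu t (σ (rangeFactorization A t))
    rw [h, edist_self, mul_zero, nonpos_iff_eq_zero, edist_eq_zero] at this
    exact this
  have hlip : LipschitzWith C fun x : range A => u (σ x) := fun x y => by
    refine (hu _ _).trans ?_
    rw [hσ, hσ]
    rfl
  rw [hfac]
  exact hlip.continuous.stronglyMeasurable.comp_measurable (hA.subtype_mk)

/-- A finitely additive set function with values in `E` that is dominated by `M • ν`. -/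
structure IsDominated (ν : Measure ℝ) (M : ℝ≥0) (m : Set ℝ → E) : Prop where
  add : ∀ S S', MeasurableSet S → MeasurableSet S' → Disjoint S S' → m (S ∪ S') = m S + m S'
  enorm_le : ∀ S, MeasurableSet S → ‖m S‖ₑ ≤ M * ν S

namespace IsDominated

variable {ν ν' : Measure ℝ} {M M' : ℝ≥0} {m m' : Set ℝ → E}

theorem sum (h : IsDominated ν M m) (h' : IsDominated ν' M' m') :
    IsDominated (ν + ν') (max M M') (fun S => m S + m' S) where
  add S S' hS hS' hd := by rw [h.add S S' hS hS' hd, h'.add S S' hS hS' hd]; abel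
  enorm_le S hS := by
    refine (enorm_add_le _ _).trans ((add_le_add (h.enorm_le S hS) (h'.enorm_le S hS)).trans ?_)
    rw [Measure.add_apply, mul_add]
    gcongr <;> simp

theorem eq_zero (h : IsDominated ν M m) {S : Set ℝ} (hS : MeasurableSet S) (h0 : ν S = 0) :
    m S = 0 := by
  have := h.enorm_le S hS
  rwa [h0, mul_zero, nonpos_iff_eq_zero, enorm_eq_zero] at this

theorem sub_eq (h : IsDominated ν M m) {S S' : Set ℝ} (hS : MeasurableSet S)
    (hS' : MeasurableSet S') (hsub : S ⊆ S') : m S' - m S = m (S' \ S) := by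
  have := h.add S (S' \ S) hS (hS'.diff hS) disjoint_sdiff_right
  rw [union_sdiff_cancel hsub] at this
  rw [this]; abel

theorem edist_le (h : IsDominated ν M m) {S S' : Set ℝ} (hS : MeasurableSet S)
    (hS' : MeasurableSet S') (hsub : S ⊆ S') (c : E) :
    edist (c + m S) (c + m S') ≤ M * ν (S' \ S) := by
  rw [edist_comm, edist_eq_enorm_sub, add_sub_add_left_eq_sub, h.sub_eq hS hS' hsub]
  exact h.enorm_le _ (hS'.diff hS)

theorem stronglyMeasurable_Iio [IsFiniteMeasure ν] (h : IsDominated ν M m) (c : E) :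
    StronglyMeasurable fun t => c + m (Iio t) := by
  have hmono : Monotone fun s => ν.real (Iio s) := fun a b hab =>
    measureReal_mono (Iio_subset_Iio hab)
  refine stronglyMeasurable_of_edist_le hmono.measurable (C := M) ?_
  have key : ∀ s t, s ≤ t → edist (c + m (Iio s)) (c + m (Iio t))
      ≤ M * edist (ν.real (Iio s)) (ν.real (Iio t)) := fun s t hst => by
    refine (h.edist_le measurableSet_Iio measurableSet_Iio (Iio_subset_Iio hst) c).trans ?_
    gcongr
    rw [edist_comm, edist_dist, Real.dist_eq, abs_of_nonneg (sub_nonneg.2 (hmono hst)),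
      ← measureReal_sdiff (Iio_subset_Iio hst) measurableSet_Iio, ofReal_measureReal]
  intro s t
  rcases le_total s t with hst | hst
  · exact key s t hst
  · rw [edist_comm, edist_comm (ν.real _)]; exact key t s hst

theorem stronglyMeasurable_Iic [IsFiniteMeasure ν] (h : IsDominated ν M m) (c : E) :
    StronglyMeasurable fun t => c + m (Iic t) := by
  have hmono : Monotone fun s => ν.real (Iic s) := fun a b hab =>
    measureReal_mono (Iic_subset_Iic.2 hab)
  refine stronglyMeasurable_of_edist_le hmono.measurable (C := M) ?_
  have key : ∀ s t, s ≤ t → edist (c + m (Iic s)) (c + m (Iic t))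
      ≤ M * edist (ν.real (Iic s)) (ν.real (Iic t)) := fun s t hst => by
    refine (h.edist_le measurableSet_Iic measurableSet_Iic (Iic_subset_Iic.2 hst) c).trans ?_
    gcongr
    rw [edist_comm, edist_dist, Real.dist_eq, abs_of_nonneg (sub_nonneg.2 (hmono hst)),
      ← measureReal_sdiff (Iic_subset_Iic.2 hst) measurableSet_Iic, ofReal_measureReal]
  intro s t
  rcases le_total s t with hst | hst
  · exact key s t hst
  · rw [edist_comm, edist_comm (ν.real _)]; exact key t s hst

theorem norm_le [IsFiniteMeasure ν] (h : IsDominated ν M m) {S : Set ℝ} (hS : MeasurableSet S)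
    (c : E) : ‖c + m S‖ ≤ ‖c‖ + M * ν.real univ := by
  refine (norm_add_le _ _).trans (add_le_add le_rfl ?_)
  have h1 := (h.enorm_le S hS).trans (mul_le_mul_right (measure_mono (subset_univ S)) _)
  have h2 := ENNReal.toReal_mono (by finiteness) h1
  simpa [Measure.real] using h2

/-- The intervals `(s, t)` shrink to the empty set as `s` increases to `t`, so their mass tends to
zero. Hence open rays give the left limits of closed rays, the link between `u` and `x`. -/
theorem tendsto_Iic [IsFiniteMeasure ν] (h : IsDominated ν M m) (c : E) (t : ℝ) :
    Tendsto (fun s => c + m (Iic s)) (𝓝[<] t) (𝓝 (c + m (Iio t))) := by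
  have h0 : Tendsto (fun s => ν (Ioo s t)) (𝓝[<] t) (𝓝 0) := by
    obtain ⟨a, ha, hat, hlim⟩ := exists_seq_strictMono_tendsto t
    have h1 : Tendsto (fun n => ν (Ioo (a n) t)) atTop (𝓝 (ν (⋂ n, Ioo (a n) t))) :=
      tendsto_measure_iInter_atTop (fun n => measurableSet_Ioo.nullMeasurableSet)
        (fun i j hij => Ioo_subset_Ioo_left (ha.monotone hij)) ⟨0, measure_ne_top _ _⟩
    have h2 : ⋂ n, Ioo (a n) t = ∅ := by
      refine eq_empty_of_forall_notMem fun x hx => ?_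
      rw [mem_iInter] at hx
      exact absurd (le_of_tendsto' hlim fun n => (hx n).1.le) (not_le.2 (hx 0).2)
    rw [h2, measure_empty] at h1
    refine ENNReal.tendsto_nhds_zero.2 fun ε hε => ?_
    obtain ⟨n, hn⟩ := ((ENNReal.tendsto_nhds_zero.1 h1) ε hε).exists
    filter_upwards [Ioo_mem_nhdsLT (hat n)] with s hs
    exact (measure_mono (Ioo_subset_Ioo_left hs.1.le)).trans hn
  rw [tendsto_iff_edist_tendsto_0]
  have h3 : Tendsto (fun s => (M : ℝ≥0∞) * ν (Ioo s t)) (𝓝[<] t) (𝓝 0) := by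
    simpa using ENNReal.Tendsto.const_mul h0 (Or.inr ENNReal.coe_ne_top)
  refine tendsto_of_tendsto_of_tendsto_of_le_of_le' tendsto_const_nhds h3
    (Eventually.of_forall fun _ => bot_le) ?_
  filter_upwards [self_mem_nhdsWithin] with s hs
  have := h.edist_le measurableSet_Iic measurableSet_Iio (Iic_subset_Iio.2 hs) c
  rwa [Iio_sdiff_Iic] at this

theorem Iic_eq_Iio (h : IsDominated ν M m) {t : ℝ} (ht : ν {t} = 0) : m (Iic t) = m (Iio t) := by
  have := h.sub_eq measurableSet_Iio measurableSet_Iic (Iio_subset_Iic_self (a := t))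
  rw [Iic_sdiff_Iio_same, h.eq_zero (measurableSet_singleton t) ht] at this
  exact sub_eq_zero.1 this

end IsDominated

/-- A nonanticipative integral operator: `I u S` is the increment over `S` generated by `u`. -/
structure IsDriver (ν : Measure ℝ) (M : ℝ≥0) (L : ℝ → ℝ≥0) (I : (ℝ → E) → Set ℝ → E) : Prop where
  dominated : ∀ u, StronglyMeasurable u → IsDominated ν M (I u)
  lip : ∀ R u v, StronglyMeasurable u → StronglyMeasurable v → (∀ t, ‖u t‖ ≤ R) →
    (∀ t, ‖v t‖ ≤ R) → ∀ S, MeasurableSet S →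
    ‖I u S - I v S‖ₑ ≤ L R * ∫⁻ s in S, ‖u s - v s‖ₑ ∂ν

namespace IsDriver

variable {ν ν' : Measure ℝ} {M M' : ℝ≥0} {L L' : ℝ → ℝ≥0} {I I' : (ℝ → E) → Set ℝ → E}

theorem sum (h : IsDriver ν M L I) (h' : IsDriver ν' M' L' I') :
    IsDriver (ν + ν') (max M M') (fun R => max (L R) (L' R)) (fun u S => I u S + I' u S) where
  dominated u hu := (h.dominated u hu).sum (h'.dominated u hu)
  lip R u v hu hv hur hvr S hS := by
    rw [add_sub_add_comm, Measure.restrict_add, lintegral_add_measure, mul_add]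
    refine (enorm_add_le _ _).trans (add_le_add ((h.lip R u v hu hv hur hvr S hS).trans ?_)
      ((h'.lip R u v hu hv hur hvr S hS).trans ?_)) <;> gcongr <;> simp

/-- Continuous dependence of solutions on the initial value. -/
theorem enorm_sub_le [IsFiniteMeasure ν] (h : IsDriver ν M L I) {c c' : E} {u u' : ℝ → E} {R : ℝ}
    (hu : StronglyMeasurable u) (hu' : StronglyMeasurable u')
    (hR : ∀ t, ‖u t‖ ≤ R) (hR' : ∀ t, ‖u' t‖ ≤ R)
    (hueq : ∀ t, u t = c + I u (Iio t)) (hueq' : ∀ t, u' t = c' + I u' (Iio t)) (t : ℝ) :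
    ‖u t - u' t‖ₑ ≤ 2 * ‖c - c'‖ₑ * expWeight ν (L R) t := by
  refine le_of_le_add_lintegral ν (L R) (φ := fun t => ‖u t - u' t‖ₑ) (δ := ‖c - c'‖ₑ)
    (B := ENNReal.ofReal (R + R)) ENNReal.ofReal_ne_top (fun t => ?_) (fun t => ?_) t
  · rw [← ofReal_norm]
    exact ENNReal.ofReal_le_ofReal ((norm_sub_le _ _).trans (add_le_add (hR t) (hR' t)))
  · have : u t - u' t = (c - c') + (I u (Iio t) - I u' (Iio t)) := by
      rw [hueq t, hueq' t]; abel
    simp only [this]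
    refine (enorm_add_le _ _).trans (add_le_add le_rfl ?_)
    exact h.lip R u u' hu hu' hR hR' _ measurableSet_Iio

theorem norm_solution_le [IsFiniteMeasure ν] (h : IsDriver ν M L I) {c : E} {u : ℝ → E}
    (hu : StronglyMeasurable u) (hueq : ∀ t, u t = c + I u (Iio t)) (t : ℝ) :
    ‖u t‖ ≤ ‖c‖ + M * ν.real univ := by
  rw [hueq t]; exact (h.dominated u hu).norm_le measurableSet_Iio c

theorem solution_unique [IsFiniteMeasure ν] (h : IsDriver ν M L I) {c : E} {u u' : ℝ → E}
    (hu : StronglyMeasurable u) (hu' : StronglyMeasurable u')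
    (hueq : ∀ t, u t = c + I u (Iio t)) (hueq' : ∀ t, u' t = c + I u' (Iio t)) : u = u' := by
  funext t
  have := h.enorm_sub_le hu hu' (h.norm_solution_le hu hueq) (h.norm_solution_le hu' hueq') hueq
    hueq' t
  simpa [sub_eq_zero] using this

/-- Picard iteration from zero. All iterates stay in one ball, so a single Lipschitz constant
applies, and successive differences relative to `expWeight` halve at each stage. -/
theorem exists_solution [CompleteSpace E] [IsFiniteMeasure ν] (h : IsDriver ν M L I) (c : E) :
    ∃ u, StronglyMeasurable u ∧ ∀ t, u t = c + I u (Iio t) := by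
  set R : ℝ := ‖c‖ + M * ν.real univ with hR
  have hR0 : 0 ≤ R := by positivity
  let U : ℕ → ℝ → E := fun k => Nat.rec (fun _ => 0) (fun _ u t => c + I u (Iio t)) k
  have hUs : ∀ k t, U (k + 1) t = c + I (U k) (Iio t) := fun k t => rfl
  have hUm : ∀ k, StronglyMeasurable (U k) := by
    intro k
    induction k with
    | zero => exact stronglyMeasurable_const
    | succ k ih => exact (h.dominated _ ih).stronglyMeasurable_Iio c
  have hUR : ∀ k t, ‖U k t‖ ≤ R := by
    intro k t
    cases k with
    | zero => simpa [U] using hR0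
    | succ k => rw [hUs]; exact (h.dominated _ (hUm k)).norm_le measurableSet_Iio c
  set W := expWeight ν (L R) with hW
  set B := ENNReal.ofReal (R + R) with hB
  have hstep : ∀ k t, ‖U k t - U (k + 1) t‖ₑ ≤ B * W t / 2 ^ k := by
    intro k
    induction k with
    | zero =>
      intro t
      rw [pow_zero, div_one]
      refine le_trans ?_ (le_mul_of_one_le_right bot_le (one_le_expWeight ν (L R) t))
      rw [← ofReal_norm]
      exact ENNReal.ofReal_le_ofReal ((norm_sub_le _ _).trans (add_le_add (hUR 0 t) (hUR 1 t)))
    | succ k ih =>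
      intro t
      rw [hUs k, hUs (k + 1), add_sub_add_left_eq_sub]
      refine (h.lip R (U k) (U (k + 1)) (hUm k) (hUm (k + 1)) (hUR k)
        (hUR (k + 1)) _ measurableSet_Iio).trans ?_
      calc (L R : ℝ≥0∞) * ∫⁻ s in Iio t, ‖U k s - U (k + 1) s‖ₑ ∂ν
          ≤ L R * ∫⁻ s in Iio t, B / 2 ^ k * W s ∂ν := by
            gcongr with s
            refine (ih s).trans (le_of_eq ?_)
            simp only [div_eq_mul_inv]; ring
        _ = B / 2 ^ k * (L R * ∫⁻ s in Iio t, W s ∂ν) := by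
            rw [lintegral_const_mul' _ _ (by finiteness)]; ring
        _ ≤ B / 2 ^ k * (W t / 2) := by gcongr; exact lintegral_expWeight_le ν (L R) t
        _ = B * W t / 2 ^ (k + 1) := by
            simp only [div_eq_mul_inv, pow_succ, ENNReal.mul_inv (Or.inr ENNReal.ofNat_ne_top)
              (Or.inr two_ne_zero)]
            ring
  have hBW : ∀ t, B * W t ≠ ∞ := fun t => ENNReal.mul_ne_top ENNReal.ofReal_ne_top
    (expWeight_ne_top ν (L R) t)
  have hstep' : ∀ t k, edist (U k t) (U (k + 1) t) ≤ B * W t / 2 ^ k := fun t k => by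
    rw [edist_eq_enorm_sub]; exact hstep k t
  choose u hu using fun t => cauchySeq_tendsto_of_complete
    (cauchySeq_of_edist_le_geometric_two (B * W t) (hBW t) (hstep' t))
  have hum : StronglyMeasurable u :=
    stronglyMeasurable_of_tendsto atTop hUm (tendsto_pi_nhds.2 hu)
  have huR : ∀ t, ‖u t‖ ≤ R := fun t => le_of_tendsto' (hu t).norm fun k => hUR k t
  refine ⟨u, hum, fun t => ?_⟩
  refine tendsto_nhds_unique ((tendsto_add_atTop_iff_nat 1).2 (hu t)) ?_
  simp only [hUs]
  refine tendsto_const_nhds.add ?_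
  rw [tendsto_iff_edist_tendsto_0]
  -- A bound, uniform in `s`, for the geometric tail `2 B W s`: convergence is uniform, which allows
  -- passing to the limit inside the operator.
  set D := 2 * (B * ENNReal.ofReal (Real.exp ((2 * L R + 1) * ν.real univ))) with hD
  have hDt : L R * (D * ν univ) ≠ ∞ := by finiteness
  have hlim : Tendsto (fun k : ℕ => L R * (D * ν univ) / 2 ^ k) atTop (𝓝 0) := by
    have h2 := ENNReal.Tendsto.const_mul (a := L R * (D * ν univ))
      (ENNReal.tendsto_pow_atTop_nhds_zero_of_lt_one (r := 2⁻¹) (by simp)) (Or.inr hDt)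
    simpa [div_eq_mul_inv, ENNReal.inv_pow] using h2
  refine tendsto_of_tendsto_of_tendsto_of_le_of_le tendsto_const_nhds hlim
    (fun _ => bot_le) fun k => ?_
  rw [edist_eq_enorm_sub]
  refine (h.lip R _ _ (hUm k) hum (hUR k) huR _ measurableSet_Iio).trans ?_
  calc (L R : ℝ≥0∞) * ∫⁻ s in Iio t, ‖U k s - u s‖ₑ ∂ν
      ≤ L R * ∫⁻ s in Iio t, D / 2 ^ k ∂ν := by
        gcongr with s
        rw [← edist_eq_enorm_sub]
        refine (edist_le_of_edist_le_geometric_two_of_tendsto _ (hstep' s) (hu s) k).trans ?_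
        gcongr
        rw [hD]
        gcongr
        exact expWeight_le ν (L R) s _ le_rfl
    _ ≤ L R * (D / 2 ^ k * ν univ) := by
        rw [lintegral_const]
        gcongr
        exact Measure.restrict_le_self
    _ = _ := by simp only [div_eq_mul_inv]; ring

end IsDriver

end Volterra

/-! ### Integrals and sums of jumps as nonanticipative operators. -/

section Drivers

variable {E : Type*} [NormedAddCommGroup E]

/-- A continuous map bounded by `M` and `L R`-Lipschitz on each ball of radius `R`. -/
structure IsTameField (M : ℝ≥0) (L : ℝ → ℝ≥0) (F : E × E → E) : Prop where
  continuous : Continuous F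
  norm_le : ∀ p, ‖F p‖ ≤ M
  lipschitzOn : ∀ R, LipschitzOnWith (L R) F (Metric.closedBall 0 R)

theorem isDominated_integral [NormedSpace ℝ E] {σ : Measure ℝ} [IsFiniteMeasure σ] {M : ℝ≥0}
    {F : ℝ → E} (hF : AEStronglyMeasurable F σ) (hb : ∀ᵐ s ∂σ, ‖F s‖ ≤ M) :
    IsDominated σ M fun S => ∫ s in S, F s ∂σ where
  add S S' _ hS' hd := by
    have hi : Integrable F σ := Integrable.of_bound hF M hb
    exact setIntegral_union hd hS' hi.integrableOn hi.integrableOn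
  enorm_le S hS := by
    refine (enorm_integral_le_lintegral_enorm _).trans ?_
    calc ∫⁻ s in S, ‖F s‖ₑ ∂σ ≤ ∫⁻ _ in S, (M : ℝ≥0∞) ∂σ := by
          refine lintegral_mono_ae (ae_restrict_of_ae (hb.mono fun s hs => ?_))
          rw [← ofReal_norm, ← ENNReal.ofReal_coe_nnreal]
          exact ENNReal.ofReal_le_ofReal hs
      _ = M * σ S := by rw [lintegral_const, Measure.restrict_apply_univ]

theorem IsTameField.aestronglyMeasurable {M : ℝ≥0} {L : ℝ → ℝ≥0}
    {F : E × E → E} (hF : IsTameField M L F) {σ : Measure ℝ} {u y : ℝ → E}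
    (hu : AEStronglyMeasurable u σ) (hy : AEStronglyMeasurable y σ) :
    AEStronglyMeasurable (fun s => F (u s, y s)) σ :=
  hF.continuous.comp_aestronglyMeasurable (hu.prodMk hy)

theorem isDriver_integral [NormedSpace ℝ E] {σ : Measure ℝ} [IsFiniteMeasure σ] {M : ℝ≥0}
    {L : ℝ → ℝ≥0} {F : E × E → E} (hF : IsTameField M L F) {y : ℝ → E} {Ry : ℝ}
    (hy : AEStronglyMeasurable y σ) (hyb : ∀ᵐ s ∂σ, ‖y s‖ ≤ Ry) :
    IsDriver σ M (fun R => L (max R Ry)) fun u S => ∫ s in S, F (u s, y s) ∂σ where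
  dominated u hu := isDominated_integral
    (hF.aestronglyMeasurable hu.aestronglyMeasurable hy) (ae_of_all _ fun s => hF.norm_le _)
  lip R u v hu hv hur hvr S hS := by
    have hi : ∀ u : ℝ → E, StronglyMeasurable u → Integrable (fun s => F (u s, y s)) σ :=
      fun u hu => Integrable.of_bound (hF.aestronglyMeasurable hu.aestronglyMeasurable hy) M
        (ae_of_all _ fun s => hF.norm_le _)
    rw [← integral_sub (hi u hu).integrableOn (hi v hv).integrableOn]
    refine (enorm_integral_le_lintegral_enorm _).trans ?_
    rw [← lintegral_const_mul' _ _ ENNReal.coe_ne_top]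
    refine lintegral_mono_ae (ae_restrict_of_ae (hyb.mono fun s hs => ?_))
    have hmem : ∀ a : E, ‖a‖ ≤ R → (a, y s) ∈ Metric.closedBall (0 : E × E) (max R Ry) :=
      fun a ha => by
        rw [mem_closedBall_zero_iff, Prod.norm_def]
        exact max_le_max ha hs
    have := (hF.lipschitzOn (max R Ry)) (hmem _ (hur s)) (hmem _ (hvr s))
    rw [Prod.edist_eq] at this
    simpa [edist_eq_enorm_sub] using this

/-- The sum of the jumps `j i` located at the points `p i` of `S`. -/
noncomputable def jumpSum {ι : Type*} (p : ι → ℝ) (j : ι → E) (S : Set ℝ) : E :=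
  ∑' i, (p ⁻¹' S).indicator j i

/-- Each finite partial sum is an integral over a finite subset of `S`. Neither `φ` nor `S` has to
be measurable. -/
theorem tsum_atoms_le {ι : Type*} {p : ι → ℝ} (hp : Function.Injective p) (μ : Measure ℝ)
    (φ : ℝ → ℝ≥0∞) (S : Set ℝ) :
    ∑' i, (p ⁻¹' S).indicator (fun i => φ (p i) * μ {p i}) i ≤ ∫⁻ s in S, φ s ∂μ := by
  classical
  rw [ENNReal.tsum_eq_iSup_sum]
  refine iSup_le fun F => ?_
  have h1 : ∑ i ∈ F, (p ⁻¹' S).indicator (fun i => φ (p i) * μ {p i}) i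
      = ∑ i ∈ F with p i ∈ S, φ (p i) * μ {p i} := by
    rw [Finset.sum_filter]
    rfl
  rw [h1, ← Finset.sum_image (f := fun s => φ s * μ {s}) (g := p) hp.injOn, ← lintegral_finset]
  exact lintegral_mono_set fun s hs => by
    obtain ⟨i, hi, rfl⟩ := Finset.mem_image.1 hs
    exact (Finset.mem_filter.1 hi).2

variable {ι : Type*} {p : ι → ℝ} {μ : Measure ℝ} [IsFiniteMeasure μ] {M : ℝ≥0}

theorem summable_jumps [CompleteSpace E] (hp : Function.Injective p) {j : ι → E}
    (hj : ∀ i, ‖j i‖ₑ ≤ M * μ {p i}) : Summable j := by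
  refine Summable.of_enorm (ne_top_of_le_ne_top (b := M * μ univ) (by finiteness) ?_)
  have := tsum_atoms_le hp μ (fun _ => M) univ
  simp only [preimage_univ, indicator_univ, lintegral_const, Measure.restrict_univ] at this
  exact (ENNReal.tsum_le_tsum hj).trans this

theorem isDominated_jumpSum [CompleteSpace E] (hp : Function.Injective p) {j : ι → E}
    (hj : ∀ i, ‖j i‖ₑ ≤ M * μ {p i}) : IsDominated μ M (jumpSum p j) where
  add S S' hS hS' hd := by
    have hs := summable_jumps hp hj
    rw [jumpSum, jumpSum, jumpSum, ← (hs.indicator _).tsum_add (hs.indicator _)]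
    congr 1
    rw [preimage_union, indicator_union_of_disjoint (hd.preimage p)]
  enorm_le S hS := by
    refine enorm_tsum_le_tsum_enorm.trans ?_
    refine (ENNReal.tsum_le_tsum fun i => ?_).trans
      ((tsum_atoms_le hp μ (fun _ => M) S).trans_eq ?_)
    · rw [enorm_indicator_eq_indicator_enorm]
      exact indicator_le_indicator (hj i)
    · rw [lintegral_const, Measure.restrict_apply_univ]

/-- Bounds proportional to the mass of the atom turn sums over jump points into integrals against
`μ`, by `tsum_atoms_le`. -/
theorem isDriver_jumpSum [CompleteSpace E] (hp : Function.Injective p) {J : ι → E → E}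
    {L : ℝ → ℝ≥0} (hJ : ∀ i ξ, ‖J i ξ‖ₑ ≤ M * μ {p i})
    (hL : ∀ R i ξ ξ', ‖ξ‖ ≤ R → ‖ξ'‖ ≤ R → ‖J i ξ - J i ξ'‖ₑ ≤ L R * ‖ξ - ξ'‖ₑ * μ {p i}) :
    IsDriver μ M L fun u S => jumpSum p (fun i => J i (u (p i))) S where
  dominated u _ := isDominated_jumpSum hp fun i => hJ i _
  lip R u v hu hv hur hvr S hS := by
    have hs : ∀ u : ℝ → E, Summable fun i => J i (u (p i)) := fun u =>
      summable_jumps hp fun i => hJ i _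
    rw [jumpSum, jumpSum, ← ((hs u).indicator _).tsum_sub ((hs v).indicator _)]
    refine enorm_tsum_le_tsum_enorm.trans ?_
    rw [← lintegral_const_mul' _ _ ENNReal.coe_ne_top]
    refine (ENNReal.tsum_le_tsum fun i => ?_).trans
      (tsum_atoms_le hp μ (fun s => L R * ‖u s - v s‖ₑ) S)
    by_cases hi : i ∈ p ⁻¹' S
    · simpa only [indicator_of_mem hi] using hL R i _ _ (hur _) (hvr _)
    · simp [indicator_of_notMem hi]

end Drivers

/-! ### Atoms and the atom-free part of a measure. -/

theorem countable_atoms (μ : Measure ℝ) [IsFiniteMeasure μ] : {t : ℝ | μ {t} ≠ 0}.Countable := by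
  have := Measure.countable_meas_pos_of_disjoint_iUnion (μ := μ) (As := fun t : ℝ => {t})
    (fun t => measurableSet_singleton t) (fun a b hab => by simpa using hab)
  simpa [pos_iff_ne_zero] using this

theorem measurableSet_nonatoms (μ : Measure ℝ) [IsFiniteMeasure μ] :
    MeasurableSet {t : ℝ | μ {t} = 0} := by
  have := (countable_atoms μ).measurableSet.compl
  convert this using 1
  ext t; simp

theorem ae_continuousPart (μ : Measure ℝ) [IsFiniteMeasure μ] :
    ∀ᵐ t ∂(continuousPart μ), μ {t} = 0 :=
  ae_restrict_mem (measurableSet_nonatoms μ)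

theorem continuousPart_singleton (μ : Measure ℝ) [IsFiniteMeasure μ] (t : ℝ) :
    continuousPart μ {t} = 0 := by
  rw [continuousPart, Measure.restrict_apply (measurableSet_singleton t)]
  by_cases h : μ {t} = 0
  · exact measure_mono_null inter_subset_left h
  · rw [show {t} ∩ {t : ℝ | μ {t} = 0} = ∅ from singleton_inter_eq_empty.2 h, measure_empty]

instance (μ : Measure ℝ) [IsFiniteMeasure μ] : IsFiniteMeasure (continuousPart μ) := by
  unfold continuousPart; infer_instance

/-! ### Jump arcs as solutions of a Volterra equation on the unit interval. -/

section Arcs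

theorem absolutelyContinuousOnInterval_of_dist_le {X Y : Type*} [PseudoMetricSpace X]
    [PseudoMetricSpace Y] {u : ℝ → X} {V : ℝ → Y} {a b : ℝ}
    (hV : AbsolutelyContinuousOnInterval V a b)
    (h : ∀ x ∈ uIcc a b, ∀ y ∈ uIcc a b, dist (u x) (u y) ≤ dist (V x) (V y)) :
    AbsolutelyContinuousOnInterval u a b := by
  rw [absolutelyContinuousOnInterval_iff] at hV ⊢
  intro ε hε
  obtain ⟨δ, hδ, hV⟩ := hV ε hε
  refine ⟨δ, hδ, fun P hP hlt => (Finset.sum_le_sum fun i hi => ?_).trans_lt (hV P hP hlt)⟩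
  exact h _ (hP.1 i hi).1 _ (hP.1 i hi).2

/-- The measure `ω ds` on `[0,1]`. -/
noncomputable def arcMeasure (ω : ℝ → ℝ≥0) : Measure ℝ :=
  (volume.restrict (Icc 0 1)).withDensity fun s => (ω s : ℝ≥0∞)

theorem arcMeasure_univ (ω : ℝ → ℝ≥0) :
    arcMeasure ω univ = ∫⁻ s in Icc (0 : ℝ) 1, (ω s : ℝ≥0∞) := by
  rw [arcMeasure, withDensity_apply _ MeasurableSet.univ, Measure.restrict_univ]

variable {E : Type*} [NormedAddCommGroup E] {ω : ℝ → ℝ≥0} {η : ℝ → E} {m : ℝ≥0} {Rη : ℝ}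

/-- Admissible data for an arc: a weight of mass at most `m` and a bounded input. -/
structure IsArcData (ω : ℝ → ℝ≥0) (η : ℝ → E) (m : ℝ≥0) (Rη : ℝ) : Prop where
  weight_meas : AEMeasurable ω (volume.restrict (Icc 0 1))
  mass_le : ∫⁻ s in Icc (0 : ℝ) 1, (ω s : ℝ≥0∞) ≤ m
  input_meas : AEStronglyMeasurable η (volume.restrict (Icc 0 1))
  input_le : ∀ s ∈ Icc (0 : ℝ) 1, ‖η s‖ ≤ Rη

theorem IsArcData.isFiniteMeasure (hd : IsArcData ω η m Rη) : IsFiniteMeasure (arcMeasure ω) :=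
  ⟨by rw [arcMeasure_univ]; exact hd.mass_le.trans_lt ENNReal.coe_lt_top⟩

theorem IsArcData.real_univ_le (hd : IsArcData ω η m Rη) : (arcMeasure ω).real univ ≤ m := by
  rw [Measure.real, arcMeasure_univ]
  exact ENNReal.toReal_le_coe_of_le_coe hd.mass_le

variable [NormedSpace ℝ E]

theorem absolutelyContinuousOnInterval_integral {G : ℝ → E} {a b : ℝ}
    (hG : IntervalIntegrable G volume a b) (c : E) :
    AbsolutelyContinuousOnInterval (fun t => c + ∫ s in a..t, G s) a b := by
  refine absolutelyContinuousOnInterval_of_dist_le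
    (hG.norm.absolutelyContinuousOnInterval_intervalIntegral (c := a) left_mem_uIcc) ?_
  have hi : ∀ x ∈ uIcc a b, IntervalIntegrable G volume a x := fun x hx =>
    hG.mono_set (uIcc_subset_uIcc left_mem_uIcc hx)
  intro x hx y hy
  rw [dist_comm, dist_comm (∫ v in a..x, _), dist_eq_norm, dist_eq_norm, add_sub_add_left_eq_sub,
    intervalIntegral.integral_interval_sub_left (hi y hy) (hi x hx),
    intervalIntegral.integral_interval_sub_left (hi y hy).norm (hi x hx).norm]
  exact intervalIntegral.norm_integral_le_abs_integral_norm

/-- `z` is an absolutely continuous solution on `[0,1]` of `dz/ds = ω g(z, η)`. -/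
structure IsArc (g : E × E → E) (ω : ℝ → ℝ≥0) (η z : ℝ → E) : Prop where
  absCont : AbsolutelyContinuousOnInterval z 0 1
  ode : ∀ᵐ s ∂(volume.restrict (Icc (0 : ℝ) 1)), HasDerivAt z ((ω s : ℝ) • g (z s, η s)) s

theorem ae_arcMeasure {ω : ℝ → ℝ≥0} {P : ℝ → Prop}
    (h : ∀ᵐ s ∂(volume.restrict (Icc (0 : ℝ) 1)), P s) : ∀ᵐ s ∂(arcMeasure ω), P s :=
  withDensity_absolutelyContinuous _ _ h

theorem ae_arcMeasure_mem (ω : ℝ → ℝ≥0) : ∀ᵐ s ∂(arcMeasure ω), s ∈ Icc (0 : ℝ) 1 :=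
  ae_arcMeasure (ae_restrict_mem measurableSet_Icc)

theorem Iio_inter_Icc_ae_eq (t : ℝ) :
    (Iio t ∩ Icc 0 1 : Set ℝ) =ᵐ[volume] Ioc 0 (max 0 (min t 1)) := by
  have h : ∀ᵐ s : ℝ, s ∉ ({0, t, 1} : Set ℝ) :=
    (Set.toFinite ({0, t, 1} : Set ℝ)).countable.ae_notMem volume
  refine h.mono fun s hs => propext ?_
  simp only [mem_insert_iff, mem_singleton_iff, not_or] at hs
  obtain ⟨h0, ht, h1⟩ := hs
  change (s < t ∧ 0 ≤ s ∧ s ≤ 1) ↔ (0 < s ∧ s ≤ max 0 (min t 1))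
  constructor
  · rintro ⟨h2, h3, h4⟩
    exact ⟨lt_of_le_of_ne h3 (Ne.symm h0), le_max_of_le_right (le_min h2.le h4)⟩
  · rintro ⟨h2, h3⟩
    rcases le_max_iff.1 h3 with h3 | h3
    · linarith
    · have := le_min_iff.1 h3
      exact ⟨lt_of_le_of_ne this.1 ht, h2.le, this.2⟩

variable {g : E × E → E} {M : ℝ≥0} {L : ℝ → ℝ≥0}

theorem integral_arcMeasure (hω : AEMeasurable ω (volume.restrict (Icc 0 1))) (F : ℝ → E) (t : ℝ) :
    ∫ s in Iio t, F s ∂(arcMeasure ω)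
      = ∫ s in (0 : ℝ)..max 0 (min t 1), (ω s : ℝ) • F s := by
  rw [arcMeasure, setIntegral_withDensity_eq_setIntegral_smul₀ hω.restrict _ measurableSet_Iio,
    Measure.restrict_restrict measurableSet_Iio, intervalIntegral.integral_of_le (le_max_left _ _),
    Measure.restrict_congr_set (Iio_inter_Icc_ae_eq t)]
  rfl

theorem intervalIntegrable_arc (hω : AEMeasurable ω (volume.restrict (Icc 0 1))) {F : ℝ → E}
    (hF : Integrable F (arcMeasure ω)) :
    IntervalIntegrable (fun s => (ω s : ℝ) • F s) volume 0 1 := by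
  rw [intervalIntegrable_iff_integrableOn_Icc_of_le zero_le_one]
  exact (integrable_withDensity_iff_integrable_smul₀ hω).1 hF

theorem max_min_eq_self {t : ℝ} (ht : t ∈ Icc (0 : ℝ) 1) : max 0 (min t 1) = t := by
  rw [min_eq_left ht.2, max_eq_right ht.1]

theorem isArc_of_solution [CompleteSpace E] (hg : IsTameField M L g)
    (hω : AEMeasurable ω (volume.restrict (Icc 0 1))) [IsFiniteMeasure (arcMeasure ω)]
    (hη : AEStronglyMeasurable η (volume.restrict (Icc 0 1))) {c : E} {u : ℝ → E}
    (hu : StronglyMeasurable u)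
    (hueq : ∀ t, u t = c + ∫ s in Iio t, g (u s, η s) ∂(arcMeasure ω)) :
    IsArc g ω η u ∧ u 0 = c := by
  have hF : Integrable (fun s => g (u s, η s)) (arcMeasure ω) :=
    Integrable.of_bound (hg.aestronglyMeasurable hu.aestronglyMeasurable
      (hη.mono_ac (withDensity_absolutelyContinuous _ _))) M (ae_of_all _ fun s => hg.norm_le _)
  have hG := intervalIntegrable_arc hω hF
  have hu' : ∀ t ∈ Icc (0 : ℝ) 1, u t = c + ∫ s in (0 : ℝ)..t, (ω s : ℝ) • g (u s, η s) := by
    intro t ht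
    rw [hueq t, integral_arcMeasure hω, max_min_eq_self ht]
  refine ⟨⟨?_, ?_⟩, ?_⟩
  · refine absolutelyContinuousOnInterval_of_dist_le
      (absolutelyContinuousOnInterval_integral hG c) fun x hx y hy => ?_
    rw [uIcc_of_le zero_le_one] at hx hy
    rw [hu' x hx, hu' y hy]
  · rw [ae_restrict_iff' measurableSet_Icc]
    -- The endpoints are discarded because the derivative is two-sided, while the integral formula
    -- for `u` is available only on `[0,1]`.
    have h01 : ∀ᵐ s : ℝ, s ∉ ({0, 1} : Set ℝ) :=
      (Set.toFinite ({0, 1} : Set ℝ)).countable.ae_notMem volume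
    filter_upwards [hG.ae_hasDerivAt_integral, h01] with s hs hs01 hmem
    simp only [mem_insert_iff, mem_singleton_iff, not_or] at hs01
    have hs' : s ∈ Ioo (0 : ℝ) 1 :=
      ⟨lt_of_le_of_ne hmem.1 (Ne.symm hs01.1), lt_of_le_of_ne hmem.2 hs01.2⟩
    have hd := (hs (by rwa [uIcc_of_le zero_le_one]) 0 left_mem_uIcc).const_add c
    refine hd.congr_of_eventuallyEq ?_
    filter_upwards [Ioo_mem_nhds hs'.1 hs'.2] with t ht using hu' t (Ioo_subset_Icc_self ht)
  · rw [hu' 0 (left_mem_Icc.2 zero_le_one)]; simp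

theorem IsArc.continuousOn {z : ℝ → E} (hz : IsArc g ω η z) : ContinuousOn z (Icc 0 1) := by
  simpa [uIcc_of_le (zero_le_one (α := ℝ))] using hz.absCont.continuousOn

theorem IsArc.aestronglyMeasurable {z : ℝ → E} (hz : IsArc g ω η z) :
    AEStronglyMeasurable z (volume.restrict (Icc 0 1)) :=
  hz.continuousOn.aestronglyMeasurable_of_isCompact isCompact_Icc measurableSet_Icc

/-- An arc, extended by constants, solves the associated integral equation. -/
theorem IsArc.exists_solution [CompleteSpace E] {z : ℝ → E} (hz : IsArc g ω η z)
    (hg : IsTameField M L g)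
    (hω : AEMeasurable ω (volume.restrict (Icc 0 1))) [IsFiniteMeasure (arcMeasure ω)]
    (hη : AEStronglyMeasurable η (volume.restrict (Icc 0 1))) :
    ∃ u, StronglyMeasurable u ∧ EqOn u z (Icc 0 1) ∧
      ∀ t, u t = z 0 + ∫ s in Iio t, g (u s, η s) ∂(arcMeasure ω) := by
  have hmem : ∀ t : ℝ, max 0 (min t 1) ∈ Icc (0 : ℝ) 1 := fun t =>
    ⟨le_max_left _ _, max_le zero_le_one (min_le_right _ _)⟩
  set u : ℝ → E := fun t => z (max 0 (min t 1)) with hu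
  have hcont : Continuous u := by
    rw [← continuousOn_univ]
    exact hz.continuousOn.comp (by fun_prop) fun t _ => hmem t
  have huz : EqOn u z (Icc 0 1) := fun t ht => by simp only [hu, max_min_eq_self ht]
  refine ⟨u, hcont.stronglyMeasurable, huz, fun t => ?_⟩
  have hF : Integrable (fun s => g (u s, η s)) (arcMeasure ω) :=
    Integrable.of_bound (hg.aestronglyMeasurable hcont.aestronglyMeasurable
      (hη.mono_ac (withDensity_absolutelyContinuous _ _))) M (ae_of_all _ fun s => hg.norm_le _)
  have hG := intervalIntegrable_arc hω hF
  -- The arc minus the integral of its derivative is absolutely continuous with zero derivative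
  -- almost everywhere, hence constant.
  have hac := hz.absCont.sub (absolutelyContinuousOnInterval_integral hG 0)
  obtain ⟨C, hC⟩ := hac.const_of_ae_hasDerivAt_zero (by
    rw [uIcc_of_le zero_le_one]
    filter_upwards [hG.ae_hasDerivAt_integral, (ae_restrict_iff' measurableSet_Icc).1 hz.ode]
      with s hs hode hs01
    have h1 := (hs (by rwa [uIcc_of_le zero_le_one]) 0 left_mem_uIcc).const_add 0
    have h2 := (hode hs01).sub h1
    rwa [huz hs01, sub_self] at h2)
  rw [uIcc_of_le zero_le_one] at hC
  have h0 := hC 0 (left_mem_Icc.2 zero_le_one)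
  have ht := hC _ (hmem t)
  rw [integral_arcMeasure hω]
  simp only [Pi.sub_apply, intervalIntegral.integral_same, zero_add, sub_zero] at h0 ht
  rw [h0, ← ht]
  simp [hu]

theorem isDriver_arc (hg : IsTameField M L g) [IsFiniteMeasure (arcMeasure ω)]
    (hη : AEStronglyMeasurable η (volume.restrict (Icc 0 1)))
    (hηb : ∀ s ∈ Icc (0 : ℝ) 1, ‖η s‖ ≤ Rη) :
    IsDriver (arcMeasure ω) M (fun R => L (max R Rη))
      fun u S => ∫ s in S, g (u s, η s) ∂(arcMeasure ω) :=
  isDriver_integral hg (hη.mono_ac (withDensity_absolutelyContinuous _ _))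
    ((ae_arcMeasure_mem ω).mono hηb)

variable [CompleteSpace E]

theorem IsArcData.exists_arc (hd : IsArcData ω η m Rη) (hg : IsTameField M L g) (ξ : E) :
    ∃ z, IsArc g ω η z ∧ z 0 = ξ := by
  have := hd.isFiniteMeasure
  obtain ⟨u, hu, hueq⟩ := (isDriver_arc (ω := ω) hg hd.input_meas hd.input_le).exists_solution ξ
  exact ⟨u, isArc_of_solution hg hd.weight_meas hd.input_meas hu hueq⟩

theorem IsArcData.enorm_sub_le (hd : IsArcData ω η m Rη) (hg : IsTameField M L g) {z : ℝ → E}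
    (hz : IsArc g ω η z) {s : ℝ} (hs : s ∈ Icc (0 : ℝ) 1) :
    ‖z s - z 0‖ₑ ≤ M * ∫⁻ s in Icc (0 : ℝ) 1, (ω s : ℝ≥0∞) := by
  have := hd.isFiniteMeasure
  obtain ⟨u, hu, huz, hueq⟩ := hz.exists_solution hg hd.weight_meas hd.input_meas
  rw [← huz hs, hueq s, add_sub_cancel_left, ← arcMeasure_univ]
  exact (((isDriver_arc (ω := ω) hg hd.input_meas hd.input_le).dominated u hu).enorm_le _
    measurableSet_Iio).trans (mul_le_mul_right (measure_mono (subset_univ _)) _)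

theorem IsArcData.norm_le (hd : IsArcData ω η m Rη) (hg : IsTameField M L g) {z : ℝ → E}
    (hz : IsArc g ω η z) {s : ℝ} (hs : s ∈ Icc (0 : ℝ) 1) : ‖z s‖ ≤ ‖z 0‖ + M * m := by
  have h1 := (hd.enorm_sub_le hg hz hs).trans (mul_le_mul_right hd.mass_le _)
  have h2 : ‖z s - z 0‖ ≤ M * m := by
    rw [← ofReal_norm, ← ENNReal.coe_mul, ← ENNReal.ofReal_coe_nnreal] at h1
    exact (ENNReal.ofReal_le_ofReal_iff (by positivity)).1 h1
  calc ‖z s‖ = ‖z 0 + (z s - z 0)‖ := by congr 1; abel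
    _ ≤ _ := (norm_add_le _ _).trans (by gcongr)

theorem IsArcData.eqOn (hd : IsArcData ω η m Rη) (hg : IsTameField M L g) {z z' : ℝ → E}
    (hz : IsArc g ω η z) (hz' : IsArc g ω η z') (h0 : z 0 = z' 0) : EqOn z z' (Icc 0 1) := by
  have := hd.isFiniteMeasure
  obtain ⟨u, hu, huz, hueq⟩ := hz.exists_solution hg hd.weight_meas hd.input_meas
  obtain ⟨u', hu', huz', hueq'⟩ := hz'.exists_solution hg hd.weight_meas hd.input_meas
  rw [h0] at hueq
  have := (isDriver_arc (ω := ω) hg hd.input_meas hd.input_le).solution_unique hu hu' hueq hueq'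
  intro s hs
  rw [← huz hs, ← huz' hs, this]

/-- A Lipschitz constant of the jump, per unit of mass, as a function of the initial value. -/
noncomputable def jumpLip (L : ℝ → ℝ≥0) (M m : ℝ≥0) (Rη R : ℝ) : ℝ≥0 :=
  L (max (R + M * m) Rη) *
    (2 * Real.toNNReal (Real.exp ((2 * L (max (R + M * m) Rη) + 1) * m)))

/-- The difference of the jumps is the integral of `g (z, η) - g (z', η)` against `ω ds`. Gronwall
bounds `z - z'` by a multiple of the initial difference, and the integration supplies the factor of
mass that makes these bounds summable over atoms. -/
theorem IsArcData.jump_lipschitz (hd : IsArcData ω η m Rη) (hg : IsTameField M L g) {z z' : ℝ → E}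
    (hz : IsArc g ω η z) (hz' : IsArc g ω η z') {R : ℝ} (hR : ‖z 0‖ ≤ R) (hR' : ‖z' 0‖ ≤ R) :
    ‖(z 1 - z 0) - (z' 1 - z' 0)‖ₑ
      ≤ jumpLip L M m Rη R * ‖z 0 - z' 0‖ₑ * ∫⁻ s in Icc (0 : ℝ) 1, (ω s : ℝ≥0∞) := by
  have := hd.isFiniteMeasure
  have hdr := isDriver_arc (ω := ω) hg hd.input_meas hd.input_le
  obtain ⟨u, hu, huz, hueq⟩ := hz.exists_solution hg hd.weight_meas hd.input_meas
  obtain ⟨u', hu', huz', hueq'⟩ := hz'.exists_solution hg hd.weight_meas hd.input_meas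
  have hmass : (M : ℝ) * (arcMeasure ω).real univ ≤ M * m := by
    gcongr; exact hd.real_univ_le
  have hb : ∀ t, ‖u t‖ ≤ R + M * m := fun t =>
    (hdr.norm_solution_le hu hueq t).trans (add_le_add hR hmass)
  have hb' : ∀ t, ‖u' t‖ ≤ R + M * m := fun t =>
    (hdr.norm_solution_le hu' hueq' t).trans (add_le_add hR' hmass)
  have h1 : (1 : ℝ) ∈ Icc (0 : ℝ) 1 := right_mem_Icc.2 zero_le_one
  rw [← huz h1, ← huz' h1, hueq 1, hueq' 1, add_sub_cancel_left, add_sub_cancel_left]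
  refine (hdr.lip (R + M * m) u u' hu hu' hb hb' _ measurableSet_Iio).trans ?_
  set K := L (max (R + M * m) Rη)
  rw [← arcMeasure_univ]
  calc (K : ℝ≥0∞) * ∫⁻ s in Iio 1, ‖u s - u' s‖ₑ ∂(arcMeasure ω)
      ≤ K * ∫⁻ s in Iio 1, 2 * ‖z 0 - z' 0‖ₑ *
          ENNReal.ofReal (Real.exp ((2 * K + 1) * m)) ∂(arcMeasure ω) := by
        gcongr with s
        refine (hdr.enorm_sub_le hu hu' hb hb' hueq hueq' s).trans ?_
        gcongr
        exact expWeight_le _ K s m hd.real_univ_le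
    _ ≤ K * (2 * ‖z 0 - z' 0‖ₑ * ENNReal.ofReal (Real.exp ((2 * K + 1) * m))
          * arcMeasure ω univ) := by
        rw [lintegral_const]
        gcongr
        exact Measure.restrict_le_self
    _ = jumpLip L M m Rη R * ‖z 0 - z' 0‖ₑ * arcMeasure ω univ := by
        rw [jumpLip, ENNReal.coe_mul, ENNReal.coe_mul]
        change _ = (K : ℝ≥0∞) * ((2 : ℝ≥0) * ENNReal.ofReal (Real.exp ((2 * K + 1) * m))) * _ * _
        push_cast
        ring

end Arcs

/-! ### The impulsive equation on one delay interval. -/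

section Step

variable {E : Type*} [NormedAddCommGroup E]

/-- Convergence must be assumed: without a limit, `Function.leftLim` returns the value at the point
itself, which `(a, b)` need not determine. -/
theorem leftLim_congr {x x' : ℝ → E} {a b t : ℝ} (hx : EqOn x x' (Ioo a b)) (ht : t ∈ Ioc a b)
    {c : E} (hc : Tendsto x (𝓝[<] t) (𝓝 c)) : Function.leftLim x' t = c := by
  refine leftLim_eq_of_tendsto (hc.congr' ?_)
  filter_upwards [Ioo_mem_nhdsLT ht.1] with s hs using hx ⟨hs.1, hs.2.trans_le ht.2⟩

/-- Replaces the index set depending on `t` by a fixed one, so that the sum becomes an additive set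
function evaluated on a ray. -/
theorem tsum_Ioc_eq_jumpSum {h a t : ℝ} (φ : ℝ → E) (ht : t ∈ Ioo a (a + h)) :
    ∑' r : Ioc 0 (t - a), φ r
      = jumpSum (fun r : Ioo 0 h => (r : ℝ) + a) (fun r => φ r) (Iic t) := by
  have hsub : Ioc 0 (t - a) ⊆ Ioo 0 h := fun r hr =>
    ⟨hr.1, by have := hr.2; have := ht.2; linarith⟩
  rw [tsum_subtype (Ioc 0 (t - a)) φ, jumpSum]
  have h1 : ∀ r : Ioo 0 h, ((fun r : Ioo 0 h => (r : ℝ) + a) ⁻¹' Iic t).indicator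
      (fun r => φ r) r = (Ioc 0 (t - a)).indicator φ r := by
    intro r
    by_cases hr : (r : ℝ) + a ≤ t
    · rw [indicator_of_mem (show r ∈ (fun r : Ioo 0 h => (r : ℝ) + a) ⁻¹' Iic t from hr),
        indicator_of_mem (show (r : ℝ) ∈ Ioc 0 (t - a) from ⟨r.2.1, by linarith⟩)]
    · rw [indicator_of_notMem (show r ∉ (fun r : Ioo 0 h => (r : ℝ) + a) ⁻¹' Iic t from hr),
        indicator_of_notMem (fun hr' => hr (by have := hr'.2; linarith))]
  rw [tsum_congr h1, tsum_subtype (Ioo 0 h) ((Ioc 0 (t - a)).indicator φ), indicator_indicator,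
    inter_eq_right.2 hsub]

theorem summable_Ioc_of_Ioo [CompleteSpace E] {h a t : ℝ} {φ : ℝ → E}
    (hφ : Summable fun r : Ioo 0 h => φ r)
    (ht : t ∈ Ioo a (a + h)) : Summable fun r : Ioc 0 (t - a) => φ r := by
  have hsub : Ioc 0 (t - a) ⊆ Ioo 0 h := fun r hr =>
    ⟨hr.1, by have := hr.2; have := ht.2; linarith⟩
  exact hφ.comp_injective (inclusion_injective hsub)

variable [NormedSpace ℝ E]

/-- Data for the equation on `(a, a + h)`: jump weights `ω r`, inputs `η r` of the jump arcs and the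
delayed trajectory `y`. -/
structure IsStepData (h a : ℝ) (μ : Measure ℝ) (ω : ℝ → ℝ → ℝ≥0) (η : ℝ → ℝ → E) (y : ℝ → E)
    (m : ℝ≥0) (R : ℝ) : Prop where
  arcs : ∀ r ∈ Icc 0 h, IsArcData (ω r) (η r) m R
  mass : ∀ r ∈ Ioo 0 h, ∫⁻ s in Icc (0 : ℝ) 1, (ω r s : ℝ≥0∞) = μ {r + a}
  delay_meas : ∀ σ : Measure ℝ, AEStronglyMeasurable y (σ.restrict (Ioo a (a + h)))
  delay_le : ∀ t ∈ Ioo a (a + h), ‖y t‖ ≤ R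

/-- The trajectory `x` on `(a, a + h)` and the jump arcs `z r`, `0 ≤ r ≤ h`, satisfy the impulsive
equation with delayed trajectory `y` and delayed arcs `η`. -/
structure IsStep (h a : ℝ) (f g : E × E → E) (μ : Measure ℝ) (ω : ℝ → ℝ → ℝ≥0)
    (η : ℝ → ℝ → E) (y x : ℝ → E) (z : ℝ → ℝ → E) : Prop where
  arc : ∀ r ∈ Icc 0 h, IsArc g (ω r) (η r) (z r)
  init_zero : z 0 0 = η h 1
  init_pos : ∀ r ∈ Ioc 0 h, z r 0 = Function.leftLim x (r + a)
  summable : ∀ t ∈ Ioo a (a + h),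
    Summable fun r : Ioc 0 (t - a) => z r 1 - Function.leftLim x (r + a)
  eq : ∀ t ∈ Ioo a (a + h), x t = z 0 1 + (∫ t' in a..t, f (x t', y t'))
    + (∫ t' in Icc a t, g (x t', y t') ∂(continuousPart μ))
    + ∑' r : Ioc 0 (t - a), (z r 1 - Function.leftLim x (r + a))

section Conversion

variable {h a t : ℝ}

theorem setIntegral_Iic_volume (F : ℝ → E) (ht : t ∈ Ioo a (a + h)) :
    ∫ s in Iic t, F s ∂(volume.restrict (Ioo a (a + h))) = ∫ s in a..t, F s := by
  rw [Measure.restrict_restrict measurableSet_Iic, intervalIntegral.integral_of_le ht.1.le]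
  congr 2
  ext s
  exact ⟨fun hs => ⟨hs.2.1, hs.1⟩, fun hs => ⟨hs.2, hs.1, hs.2.trans_lt ht.2⟩⟩

theorem setIntegral_Iic_continuousPart (μ : Measure ℝ) [IsFiniteMeasure μ] (F : ℝ → E)
    (ht : t ∈ Ioo a (a + h)) :
    ∫ s in Iic t, F s ∂((continuousPart μ).restrict (Ioo a (a + h)))
      = ∫ s in Icc a t, F s ∂(continuousPart μ) := by
  -- The left endpoint can be dropped because `μ^c` has no atoms.
  rw [Measure.restrict_restrict measurableSet_Iic,
    ← setIntegral_congr_set (Ioc_ae_eq_Icc' (continuousPart_singleton μ a))]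
  congr 2
  ext s
  exact ⟨fun hs => ⟨hs.2.1, hs.1⟩, fun hs => ⟨hs.2, hs.1, hs.2.trans_lt ht.2⟩⟩

theorem intervalIntegral_step_congr {F F' : ℝ → E} (hF : EqOn F F' (Ioo a (a + h)))
    (ht : t ∈ Ioo a (a + h)) : ∫ s in a..t, F s = ∫ s in a..t, F' s := by
  rw [← setIntegral_Iic_volume F ht, ← setIntegral_Iic_volume F' ht]
  exact integral_congr_ae (ae_restrict_of_ae
    ((ae_restrict_iff' measurableSet_Ioo).2 (ae_of_all _ hF)))

theorem integral_continuousPart_step_congr {μ : Measure ℝ} [IsFiniteMeasure μ] {F F' : ℝ → E}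
    (hF : EqOn F F' (Ioo a (a + h))) (ht : t ∈ Ioo a (a + h)) :
    ∫ s in Icc a t, F s ∂(continuousPart μ) = ∫ s in Icc a t, F' s ∂(continuousPart μ) := by
  rw [← setIntegral_Iic_continuousPart μ F ht, ← setIntegral_Iic_continuousPart μ F' ht]
  exact integral_congr_ae (ae_restrict_of_ae
    ((ae_restrict_iff' measurableSet_Ioo).2 (ae_of_all _ hF)))

end Conversion

theorem add_right_injective_subtype (h a : ℝ) :
    Function.Injective fun r : Ioo 0 h => (r : ℝ) + a := fun _ _ hr =>
  Subtype.ext (add_right_cancel hr)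

variable {h a : ℝ} {f g : E × E → E} {μ : Measure ℝ} {ω : ℝ → ℝ → ℝ≥0} {η : ℝ → ℝ → E} {y : ℝ → E}
  {M m : ℝ≥0} {L : ℝ → ℝ≥0} {R : ℝ}

theorem IsStep.congr_inputs [IsFiniteMeasure μ] {y' x : ℝ → E} {η' z : ℝ → ℝ → E} (hh : 0 < h)
    (hs : IsStep h a f g μ ω η y x z) (hy : EqOn y y' (Ioo a (a + h)))
    (hη : ∀ r ∈ Icc 0 h, EqOn (η r) (η' r) (Icc 0 1)) : IsStep h a f g μ ω η' y' x z where
  arc r hr := by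
    refine ⟨(hs.arc r hr).absCont, ?_⟩
    filter_upwards [(hs.arc r hr).ode, ae_restrict_mem measurableSet_Icc] with s h1 h2
    rwa [← hη r hr h2]
  init_zero := by
    rw [hs.init_zero, hη h (right_mem_Icc.2 hh.le) (right_mem_Icc.2 zero_le_one)]
  init_pos := hs.init_pos
  summable := hs.summable
  eq t ht := by
    rw [hs.eq t ht, intervalIntegral_step_congr (F' := fun s => f (x s, y' s))
      (fun s hs => by simp only [hy hs]) ht, integral_continuousPart_step_congr
      (F' := fun s => g (x s, y' s)) (fun s hs => by simp only [hy hs]) ht]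

/-- A step sees only the values on the open interval, including through the left limit at its right
end. This is what permits gluing. -/
theorem IsStep.congr_trajectory [IsFiniteMeasure μ] {x x' : ℝ → E} {z : ℝ → ℝ → E}
    (hs : IsStep h a f g μ ω η y x z) (hx : EqOn x x' (Ioo a (a + h)))
    (hlim : ∀ t, Tendsto x (𝓝[<] t) (𝓝 (Function.leftLim x t))) :
    IsStep h a f g μ ω η y x' z := by
  have hl : ∀ r ∈ Ioc 0 h, Function.leftLim x' (r + a) = Function.leftLim x (r + a) := fun r hr =>
    leftLim_congr hx ⟨by linarith [hr.1], by linarith [hr.2]⟩ (hlim _)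
  have hl' : ∀ t ∈ Ioo a (a + h), ∀ r : Ioc 0 (t - a),
      Function.leftLim x' (r + a) = Function.leftLim x (r + a) := fun t ht r =>
    hl r ⟨r.2.1, by linarith [r.2.2, ht.2]⟩
  refine ⟨hs.arc, hs.init_zero, fun r hr => by rw [hl r hr, hs.init_pos r hr], fun t ht => ?_,
    fun t ht => ?_⟩
  · simpa only [hl' t ht] using hs.summable t ht
  · simp only [hl' t ht]
    rw [← hx ht, hs.eq t ht, intervalIntegral_step_congr (F' := fun s => f (x' s, y s))
      (fun s hs => by simp only [hx hs]) ht, integral_continuousPart_step_congr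
      (F' := fun s => g (x' s, y s)) (fun s hs => by simp only [hx hs]) ht]

/-- The increments over `S` of a trajectory with left limits `u`, jump maps `J` and delayed
trajectory `y`. -/
noncomputable def stepIncrement (h a : ℝ) (f g : E × E → E) (μ : Measure ℝ)
    (y : ℝ → E) (J : Ioo 0 h → E → E) (u : ℝ → E) (S : Set ℝ) : E :=
  (∫ s in S, f (u s, y s) ∂(volume.restrict (Ioo a (a + h)))
    + ∫ s in S, g (u s, y s) ∂((continuousPart μ).restrict (Ioo a (a + h))))
    + jumpSum (fun r : Ioo 0 h => (r : ℝ) + a) (fun r => J r (u (r + a))) S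

theorem stepIncrement_congr {J : Ioo 0 h → E → E} {x u : ℝ → E} {j : Ioo 0 h → E}
    (hvol : ∀ᵐ s ∂(volume.restrict (Ioo a (a + h))), x s = u s)
    (hcp : ∀ᵐ s ∂((continuousPart μ).restrict (Ioo a (a + h))), x s = u s)
    (hj : ∀ r : Ioo 0 h, J r (u (r + a)) = j r) (S : Set ℝ) :
    (∫ s in S, f (x s, y s) ∂(volume.restrict (Ioo a (a + h)))
      + ∫ s in S, g (x s, y s) ∂((continuousPart μ).restrict (Ioo a (a + h))))
      + jumpSum (fun r : Ioo 0 h => (r : ℝ) + a) j S = stepIncrement h a f g μ y J u S := by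
  have h1 : (fun s => f (x s, y s)) =ᵐ[volume.restrict (Ioo a (a + h))] fun s => f (u s, y s) :=
    hvol.mono fun s hs => by simp only [hs]
  have h2 : (fun s => g (x s, y s)) =ᵐ[(continuousPart μ).restrict (Ioo a (a + h))]
      fun s => g (u s, y s) := hcp.mono fun s hs => by simp only [hs]
  rw [stepIncrement, integral_congr_ae (ae_restrict_of_ae h1),
    integral_congr_ae (ae_restrict_of_ae h2)]
  simp only [hj]

/-- The right-hand side of the equation in terms of the increments. -/
theorem stepIncrement_Iic_eq [IsFiniteMeasure μ] {J : Ioo 0 h → E → E} {x u : ℝ → E}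
    {z : ℝ → ℝ → E} {c : E}
    (hvol : ∀ᵐ s ∂(volume.restrict (Ioo a (a + h))), x s = u s)
    (hcp : ∀ᵐ s ∂((continuousPart μ).restrict (Ioo a (a + h))), x s = u s)
    (hj : ∀ r : Ioo 0 h, J r (u (r + a)) = z r 1 - Function.leftLim x (r + a))
    {t : ℝ} (ht : t ∈ Ioo a (a + h)) :
    c + stepIncrement h a f g μ y J u (Iic t) = c + (∫ t' in a..t, f (x t', y t'))
      + (∫ t' in Icc a t, g (x t', y t') ∂(continuousPart μ))
      + ∑' r : Ioc 0 (t - a), (z r 1 - Function.leftLim x (r + a)) := by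
  rw [← setIntegral_Iic_volume _ ht, ← setIntegral_Iic_continuousPart μ _ ht,
    tsum_Ioc_eq_jumpSum (fun r => z r 1 - Function.leftLim x (r + a)) ht,
    ← stepIncrement_congr hvol hcp hj]
  simp only [add_assoc]

/-- The measure that dominates the increments of the trajectories. -/
noncomputable def stepMeasure (h a : ℝ) (μ : Measure ℝ) : Measure ℝ :=
  volume.restrict (Ioo a (a + h)) + (continuousPart μ).restrict (Ioo a (a + h)) + μ

instance [IsFiniteMeasure μ] : IsFiniteMeasure (stepMeasure h a μ) := by
  unfold stepMeasure; infer_instance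

/-- `J r` maps the left limit at `r + a` to the jump there. -/
structure IsJumpMap (h a : ℝ) (g : E × E → E) (μ : Measure ℝ) (ω : ℝ → ℝ → ℝ≥0) (η : ℝ → ℝ → E)
    (M : ℝ≥0) (L : ℝ → ℝ≥0) (J : Ioo 0 h → E → E) : Prop where
  eq : ∀ (r : Ioo 0 h) z, IsArc g (ω r) (η r) z → J r (z 0) = z 1 - z 0
  enorm_le : ∀ (r : Ioo 0 h) ξ, ‖J r ξ‖ₑ ≤ M * μ {(r : ℝ) + a}
  lip : ∀ R (r : Ioo 0 h) ξ ξ', ‖ξ‖ ≤ R → ‖ξ'‖ ≤ R →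
    ‖J r ξ - J r ξ'‖ₑ ≤ L R * ‖ξ - ξ'‖ₑ * μ {(r : ℝ) + a}

variable [CompleteSpace E]

/-- Choose one arc for every initial value; uniqueness of arcs makes the chosen jump correct for any
other arc with that initial value. -/
theorem IsStepData.exists_jumpMap (hd : IsStepData h a μ ω η y m R) (hg : IsTameField M L g) :
    ∃ J, IsJumpMap h a g μ ω η M (jumpLip L M m R) J := by
  have hda : ∀ r : Ioo 0 h, IsArcData (ω r) (η r) m R := fun r =>
    hd.arcs r (Ioo_subset_Icc_self r.2)
  choose Z hZ hZ0 using fun r ξ => (hda r).exists_arc hg ξ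
  have h1 : (1 : ℝ) ∈ Icc (0 : ℝ) 1 := right_mem_Icc.2 zero_le_one
  refine ⟨fun r ξ => Z r ξ 1 - ξ, fun r z hz => ?_, fun r ξ => ?_, fun R' r ξ ξ' hξ hξ' => ?_⟩
  · simp only [(hda r).eqOn hg (hZ r (z 0)) hz (hZ0 r (z 0)) h1]
  · rw [← hd.mass r r.2]
    simpa only [hZ0] using (hda r).enorm_sub_le hg (hZ r ξ) h1
  · rw [← hd.mass r r.2]
    have := (hda r).jump_lipschitz hg (hZ r ξ) (hZ r ξ') (R := R') (by rwa [hZ0]) (by rwa [hZ0])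
    simpa only [hZ0] using this

variable [IsFiniteMeasure μ]

theorem IsStepData.isDriver (hd : IsStepData h a μ ω η y m R) (hf : IsTameField M L f)
    (hg : IsTameField M L g) {L' : ℝ → ℝ≥0} {J : Ioo 0 h → E → E}
    (hJ : IsJumpMap h a g μ ω η M L' J) :
    ∃ L'', IsDriver (stepMeasure h a μ) M L'' (stepIncrement h a f g μ y J) := by
  have hb : ∀ σ : Measure ℝ, ∀ᵐ s ∂(σ.restrict (Ioo a (a + h))), ‖y s‖ ≤ R := fun σ =>
    (ae_restrict_iff' measurableSet_Ioo).2 (ae_of_all _ hd.delay_le)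
  have h1 := isDriver_integral hf (hd.delay_meas volume) (hb _)
  have h2 := isDriver_integral hg (hd.delay_meas (continuousPart μ)) (hb _)
  have h3 := isDriver_jumpSum (add_right_injective_subtype h a) hJ.enorm_le hJ.lip
  have h4 := (h1.sum h2).sum h3
  rw [max_self, max_self] at h4
  exact ⟨_, h4⟩

/-- This is why `x` may be replaced by its left limits inside both integrals. -/
theorem ae_stepMeasure_singleton_eq_zero :
    (∀ᵐ t ∂(volume.restrict (Ioo a (a + h))), stepMeasure h a μ {t} = 0) ∧
    ∀ᵐ t ∂((continuousPart μ).restrict (Ioo a (a + h))), stepMeasure h a μ {t} = 0 := by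
  have key : ∀ t, μ {t} = 0 → stepMeasure h a μ {t} = 0 := by
    intro t ht
    have h1 : volume.restrict (Ioo a (a + h)) {t} = 0 :=
      Measure.absolutelyContinuous_of_le Measure.restrict_le_self (measure_singleton t)
    have h2 : (continuousPart μ).restrict (Ioo a (a + h)) {t} = 0 :=
      Measure.absolutelyContinuous_of_le Measure.restrict_le_self (continuousPart_singleton μ t)
    simp [stepMeasure, h1, h2, ht]
  refine ⟨ae_restrict_of_ae ?_, ae_restrict_of_ae ((ae_continuousPart μ).mono key)⟩
  refine ((countable_atoms μ).ae_notMem volume).mono fun t ht => key t ?_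
  simpa using ht

/-- The left limits of a trajectory solve the integral equation. -/
theorem IsStep.exists_leftLim_solution {x : ℝ → E} {z : ℝ → ℝ → E}
    (hs : IsStep h a f g μ ω η y x z) (hd : IsStepData h a μ ω η y m R) (hf : IsTameField M L f)
    (hg : IsTameField M L g) {L' : ℝ → ℝ≥0} {J : Ioo 0 h → E → E}
    (hJ : IsJumpMap h a g μ ω η M L' J)
    (hx : ∀ σ : Measure ℝ, AEStronglyMeasurable x (σ.restrict (Ioo a (a + h)))) :
    ∃ u, StronglyMeasurable u ∧ (∀ t, u t = z 0 1 + stepIncrement h a f g μ y J u (Iio t)) ∧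
      (∀ t ∈ Ioo a (a + h), x t = z 0 1 + stepIncrement h a f g μ y J u (Iic t)) ∧
      ∀ t ∈ Ioc a (a + h), Function.leftLim x t = u t := by
  set ν := stepMeasure h a μ
  set j : Ioo 0 h → E := fun r => z r 1 - Function.leftLim x (r + a) with hjdef
  have hjJ : ∀ r : Ioo 0 h, J r (Function.leftLim x (r + a)) = j r := fun r => by
    simp only [hjdef]
    rw [← hs.init_pos r (Ioo_subset_Ioc_self r.2)]
    exact hJ.eq r _ (hs.arc r (Ioo_subset_Icc_self r.2))
  -- The increments written with `x` itself. Their domination already yields left limits `u`; only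
  -- afterwards is `k` identified with the increments generated by `u`.
  set k : Set ℝ → E := fun S => (∫ s in S, f (x s, y s) ∂(volume.restrict (Ioo a (a + h)))
    + ∫ s in S, g (x s, y s) ∂((continuousPart μ).restrict (Ioo a (a + h))))
    + jumpSum (fun r : Ioo 0 h => (r : ℝ) + a) j S with hk
  have hdom : IsDominated ν M k := by
    have h1 := isDominated_integral (hf.aestronglyMeasurable (hx volume) (hd.delay_meas volume))
      (ae_of_all _ fun s => hf.norm_le _)
    have h2 := isDominated_integral (hg.aestronglyMeasurable (hx (continuousPart μ))
      (hd.delay_meas (continuousPart μ))) (ae_of_all _ fun s => hg.norm_le _)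
    have h3 := isDominated_jumpSum (μ := μ) (M := M) (add_right_injective_subtype h a) (j := j)
      fun r => by rw [← hjJ]; exact hJ.enorm_le r _
    have h4 := (h1.sum h2).sum h3
    rwa [max_self, max_self] at h4
  have hxk : ∀ t ∈ Ioo a (a + h), x t = z 0 1 + k (Iic t) := by
    intro t ht
    rw [hs.eq t ht, ← setIntegral_Iic_volume _ ht, ← setIntegral_Iic_continuousPart μ _ ht,
      tsum_Ioc_eq_jumpSum (fun r => z r 1 - Function.leftLim x (r + a)) ht, hk]
    simp only [add_assoc, hjdef]
  set u : ℝ → E := fun t => z 0 1 + k (Iio t) with hu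
  have hleft : ∀ t ∈ Ioc a (a + h), Function.leftLim x t = u t := fun t ht =>
    leftLim_congr (fun s hs => (hxk s hs).symm) ht (hdom.tendsto_Iic _ t)
  have hxu : ∀ t ∈ Ioo a (a + h), ν {t} = 0 → x t = u t := fun t ht h0 => by
    rw [hxk t ht, hu, hdom.Iic_eq_Iio h0]
  have hvol : ∀ᵐ s ∂(volume.restrict (Ioo a (a + h))), x s = u s := by
    filter_upwards [(ae_stepMeasure_singleton_eq_zero (μ := μ) (h := h) (a := a)).1,
      ae_restrict_mem measurableSet_Ioo] with t h0 ht using hxu t ht h0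
  have hcp : ∀ᵐ s ∂((continuousPart μ).restrict (Ioo a (a + h))), x s = u s := by
    filter_upwards [(ae_stepMeasure_singleton_eq_zero (μ := μ) (h := h) (a := a)).2,
      ae_restrict_mem measurableSet_Ioo] with t h0 ht using hxu t ht h0
  have hIk : stepIncrement h a f g μ y J u = k := by
    funext S
    refine (stepIncrement_congr hvol hcp (fun r => ?_) S).symm
    rw [← hjJ, hleft (r + a) ⟨by have := r.2.1; linarith, by have := r.2.2; linarith⟩]
  refine ⟨u, hdom.stronglyMeasurable_Iio _, fun t => ?_, fun t ht => ?_, hleft⟩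
  · rw [hIk]
  · rw [hIk, hxk t ht]

/-- The arc at `r = 0` starts at the prescribed point `η h 1`, so both left-limit functions solve
the same Volterra equation with the same constant. Their equality gives that of the trajectories and
of the initial values of the remaining arcs. -/
theorem IsStep.unique {x x' : ℝ → E} {z z' : ℝ → ℝ → E} (hh : 0 < h)
    (hs : IsStep h a f g μ ω η y x z) (hs' : IsStep h a f g μ ω η y x' z')
    (hd : IsStepData h a μ ω η y m R) (hf : IsTameField M L f) (hg : IsTameField M L g)
    (hx : ∀ σ : Measure ℝ, AEStronglyMeasurable x (σ.restrict (Ioo a (a + h))))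
    (hx' : ∀ σ : Measure ℝ, AEStronglyMeasurable x' (σ.restrict (Ioo a (a + h)))) :
    EqOn x x' (Ioo a (a + h)) ∧ ∀ r ∈ Icc 0 h, EqOn (z r) (z' r) (Icc 0 1) := by
  obtain ⟨J, hJ⟩ := hd.exists_jumpMap hg
  obtain ⟨L'', hdr⟩ := hd.isDriver hf hg hJ
  obtain ⟨u, hu, hueq, hxu, hl⟩ := hs.exists_leftLim_solution hd hf hg hJ hx
  obtain ⟨u', hu', hueq', hxu', hl'⟩ := hs'.exists_leftLim_solution hd hf hg hJ hx'
  have h0 : (0 : ℝ) ∈ Icc 0 h := left_mem_Icc.2 hh.le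
  have hz0 : EqOn (z 0) (z' 0) (Icc 0 1) :=
    (hd.arcs 0 h0).eqOn hg (hs.arc 0 h0) (hs'.arc 0 h0) (hs.init_zero.trans hs'.init_zero.symm)
  rw [← hz0 (right_mem_Icc.2 zero_le_one)] at hueq'
  have huu := hdr.solution_unique hu hu' hueq hueq'
  subst huu
  refine ⟨fun t ht => ?_, fun r hr => ?_⟩
  · rw [hxu t ht, hxu' t ht, hz0 (right_mem_Icc.2 zero_le_one)]
  · rcases hr.1.eq_or_lt with rfl | hr0
    · exact hz0
    · refine (hd.arcs r hr).eqOn hg (hs.arc r hr) (hs'.arc r hr) ?_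
      have hmem : r + a ∈ Ioc a (a + h) := ⟨by linarith, by have := hr.2; linarith⟩
      rw [hs.init_pos r ⟨hr0, hr.2⟩, hs'.init_pos r ⟨hr0, hr.2⟩, hl _ hmem, hl' _ hmem]

theorem IsStepData.exists_step (hh : 0 < h) (hd : IsStepData h a μ ω η y m R)
    (hf : IsTameField M L f) (hg : IsTameField M L g) :
    ∃ x z, StronglyMeasurable x ∧ (∀ t, Tendsto x (𝓝[<] t) (𝓝 (Function.leftLim x t))) ∧
      IsStep h a f g μ ω η y x z := by
  obtain ⟨J, hJ⟩ := hd.exists_jumpMap hg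
  obtain ⟨L'', hdr⟩ := hd.isDriver hf hg hJ
  obtain ⟨z₀, hz₀, hz₀0⟩ := (hd.arcs 0 (left_mem_Icc.2 hh.le)).exists_arc hg (η h 1)
  obtain ⟨u, hu, hueq⟩ := hdr.exists_solution (z₀ 1)
  have hdom := hdr.dominated u hu
  -- The same increments over closed rays: `x t` includes the jump at `t`, and its left limit is `u
  -- t`.
  set x : ℝ → E := fun t => z₀ 1 + stepIncrement h a f g μ y J u (Iic t) with hx
  have htend : ∀ t, Tendsto x (𝓝[<] t) (𝓝 (u t)) := fun t => by
    rw [hueq t]; exact hdom.tendsto_Iic _ t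
  have hleft : ∀ t, Function.leftLim x t = u t := fun t => leftLim_eq_of_tendsto (htend t)
  have hxu : ∀ t, stepMeasure h a μ {t} = 0 → x t = u t := fun t h0 => by
    simp only [hueq t, hx, hdom.Iic_eq_Iio h0]
  have harc : ∀ r, ∃ z, r ∈ Icc 0 h → IsArc g (ω r) (η r) z ∧ z 0 = u (r + a) := fun r => by
    by_cases hr : r ∈ Icc 0 h
    · obtain ⟨z, hz⟩ := (hd.arcs r hr).exists_arc hg (u (r + a))
      exact ⟨z, fun _ => hz⟩
    · exact ⟨0, fun hr' => absurd hr' hr⟩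
  choose Z hZ using harc
  -- The arc at `r = 0` is overwritten: it must start at `η h 1`, not at `u a`.
  have hupd : ∀ r, 0 < r → Function.update Z 0 z₀ r = Z r := fun r hr =>
    Function.update_of_ne hr.ne' _ _
  have hj : ∀ r : Ioo 0 h,
      J r (u (r + a)) = Function.update Z 0 z₀ r 1 - Function.leftLim x (r + a) := fun r => by
    have hr := hZ r (Ioo_subset_Icc_self r.2)
    rw [hupd r r.2.1, hleft, ← hr.2]
    exact hJ.eq r _ hr.1
  refine ⟨x, Function.update Z 0 z₀, hdom.stronglyMeasurable_Iic _,
    fun t => by rw [hleft]; exact htend t, ?_, ?_, ?_, ?_, ?_⟩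
  · intro r hr
    rcases hr.1.eq_or_lt with rfl | hr0
    · rwa [Function.update_self]
    · rw [hupd r hr0]; exact (hZ r hr).1
  · rwa [Function.update_self]
  · intro r hr
    rw [hupd r hr.1, hleft]
    exact (hZ r (Ioc_subset_Icc_self hr)).2
  · intro t ht
    refine summable_Ioc_of_Ioo (h := h)
      (φ := fun r => Function.update Z 0 z₀ r 1 - Function.leftLim x (r + a)) ?_ ht
    simp only [← hj]
    exact summable_jumps (add_right_injective_subtype h a) fun r => hJ.enorm_le r _
  · intro t ht
    rw [Function.update_self]
    exact stepIncrement_Iic_eq (ae_stepMeasure_singleton_eq_zero.1.mono hxu)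
      (ae_stepMeasure_singleton_eq_zero.2.mono hxu) hj ht

theorem IsStep.exists_bounds {x : ℝ → E} {z : ℝ → ℝ → E} (hh : 0 < h)
    (hs : IsStep h a f g μ ω η y x z)
    (hd : IsStepData h a μ ω η y m R) (hf : IsTameField M L f) (hg : IsTameField M L g)
    (hx : ∀ σ : Measure ℝ, AEStronglyMeasurable x (σ.restrict (Ioo a (a + h)))) :
    ∃ (B : ℝ) (A : ℝ → ℝ), (∀ t ∈ Ioo a (a + h), ‖x t‖ ≤ B) ∧
      (∀ r ∈ Icc 0 h, ∀ s ∈ Icc (0 : ℝ) 1, ‖z r s‖ ≤ B) ∧ Monotone A ∧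
      ∀ s ∈ Ioo a (a + h), ∀ t ∈ Ioo a (a + h), s ≤ t → dist (x s) (x t) ≤ A t - A s := by
  obtain ⟨J, hJ⟩ := hd.exists_jumpMap hg
  obtain ⟨L'', hdr⟩ := hd.isDriver hf hg hJ
  obtain ⟨u, hu, hueq, hxu, hl⟩ := hs.exists_leftLim_solution hd hf hg hJ hx
  have hdom := hdr.dominated u hu
  set ν := stepMeasure h a μ
  have hmono : Monotone fun s => ν.real (Iic s) := fun a b hab =>
    measureReal_mono (Iic_subset_Iic.2 hab)
  set B := ‖z 0 1‖ + M * ν.real univ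
  -- An arc starts at a left limit, bounded by `B`, or at a delayed arc's endpoint, bounded by `R`,
  -- and moves by at most `M * m`.
  refine ⟨max B (max B R + M * m), fun t => M * ν.real (Iic t), fun t ht => ?_,
    fun r hr s hs' => ?_, hmono.const_mul M.coe_nonneg, fun s hs' t ht hst => ?_⟩
  · rw [hxu t ht]
    exact (hdom.norm_le measurableSet_Iic _).trans (le_max_left _ _)
  · refine le_max_of_le_right (((hd.arcs r hr).norm_le hg (hs.arc r hr) hs').trans ?_)
    gcongr
    rcases hr.1.eq_or_lt with rfl | hr0
    · rw [hs.init_zero]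
      exact le_max_of_le_right ((hd.arcs h (right_mem_Icc.2 hh.le)).input_le 1
        (right_mem_Icc.2 zero_le_one))
    · have hmem : r + a ∈ Ioc a (a + h) := ⟨by linarith, by have := hr.2; linarith⟩
      rw [hs.init_pos r ⟨hr0, hr.2⟩, hl _ hmem]
      exact le_max_of_le_left (hdr.norm_solution_le hu hueq _)
  · have h1 := hdom.edist_le measurableSet_Iic measurableSet_Iic (Iic_subset_Iic.2 hst) (z 0 1)
    rw [← hxu s hs', ← hxu t ht, edist_dist, ← ofReal_measureReal,
      ← ENNReal.ofReal_coe_nnreal, ← ENNReal.ofReal_mul M.coe_nonneg,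
      ENNReal.ofReal_le_ofReal_iff (by positivity),
      measureReal_sdiff (Iic_subset_Iic.2 hst) measurableSet_Iic] at h1
    linarith

end Step

/-! ### Functions of bounded variation. -/

section Variation

theorem boundedVariationOn_of_dist_le {X : Type*} [PseudoMetricSpace X] {x : ℝ → X} {V : ℝ → ℝ}
    {a b : ℝ} (hV : Monotone V)
    (h : ∀ s ∈ Icc a b, ∀ t ∈ Icc a b, s ≤ t → dist (x s) (x t) ≤ V t - V s) :
    BoundedVariationOn x (Icc a b) := by
  have hVb : BoundedVariationOn V (Icc a b) :=
    (hV.monotoneOn _).boundedVariationOn (C := max |V a| |V b|) fun t ht =>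
      abs_le_max_abs_abs (hV ht.1) (hV ht.2)
  refine ne_top_of_le_ne_top hVb (iSup_mono fun p => Finset.sum_le_sum fun i _ => ?_)
  rw [edist_dist, edist_dist, dist_comm]
  refine ENNReal.ofReal_le_ofReal
    ((h _ (p.2.2.2 i) _ (p.2.2.2 (i + 1)) (p.2.2.1 i.le_succ)).trans (le_abs_self _))

/-- Extended by constants, `x` is 1-Lipschitz relative to its variation function, which is monotone
and hence measurable. -/
theorem exists_stronglyMeasurable_of_boundedVariationOn {E : Type*} [NormedAddCommGroup E]
    {x : ℝ → E} {a b : ℝ} (hab : a ≤ b) (hx : BoundedVariationOn x (Icc a b)) :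
    ∃ x', StronglyMeasurable x' ∧ EqOn x x' (Icc a b) := by
  have hloc := hx.locallyBoundedVariationOn
  have ha : a ∈ Icc a b := left_mem_Icc.2 hab
  have hmono := variationOnFromTo.monotoneOn hloc ha
  have hmem : ∀ t : ℝ, (projIcc a b hab t : ℝ) ∈ Icc a b := fun t => (projIcc a b hab t).2
  have hA : Monotone fun t => variationOnFromTo x (Icc a b) a (projIcc a b hab t) := fun s t hst =>
    hmono (hmem s) (hmem t) (monotone_projIcc hab hst)
  refine ⟨fun t => x (projIcc a b hab t), stronglyMeasurable_of_edist_le hA.measurable (C := 1) ?_,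
    fun t ht => by simp only [projIcc_of_mem hab ht]⟩
  have key : ∀ s ∈ Icc a b, ∀ t ∈ Icc a b, s ≤ t → edist (x s) (x t)
      ≤ edist (variationOnFromTo x (Icc a b) a s) (variationOnFromTo x (Icc a b) a t) := by
    intro s hs t ht hst
    have h1 := variationOnFromTo.add hloc ha hs ht
    rw [edist_comm (variationOnFromTo _ _ _ _), edist_dist (variationOnFromTo _ _ _ _),
      Real.dist_eq, ← h1,
      add_sub_cancel_left, variationOnFromTo.eq_of_le _ _ hst, abs_of_nonneg ENNReal.toReal_nonneg,
      ENNReal.ofReal_toReal (hloc s t hs ht)]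
    exact eVariationOn.edist_le _ ⟨hs, left_mem_Icc.2 hst⟩ ⟨ht, right_mem_Icc.2 hst⟩
  intro s t
  rw [ENNReal.coe_one, one_mul]
  rcases le_total s t with hst | hst
  · exact key _ (hmem s) _ (hmem t) (monotone_projIcc hab hst)
  · rw [edist_comm, edist_comm (variationOnFromTo _ _ _ _)]
    exact key _ (hmem t) _ (hmem s) (monotone_projIcc hab hst)

theorem exists_norm_le_of_boundedVariationOn {E : Type*} [NormedAddCommGroup E]
    {x : ℝ → E} {a b : ℝ} (hab : a ≤ b) (hx : BoundedVariationOn x (Icc a b)) :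
    ∃ R, ∀ t ∈ Icc a b, ‖x t‖ ≤ R := by
  have ha : a ∈ Icc a b := left_mem_Icc.2 hab
  refine ⟨(eVariationOn x (Icc a b)).toReal + ‖x a‖, fun t ht => ?_⟩
  have := hx.dist_le ht ha
  rw [dist_eq_norm] at this
  linarith [norm_le_norm_add_norm_sub' (x t) (x a)]

end Variation

/-! ### Regularity of the fields and the grid of multiples of the delay. -/

theorem exists_isTameField {F : Type*} [NormedAddCommGroup F] [NormedSpace ℝ F]
    [FiniteDimensional ℝ F] {f g : F × F → F} (hf : ContDiff ℝ 1 f) (hg : ContDiff ℝ 1 g)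
    (hfb : ∃ M : ℝ, ∀ p, ‖f p‖ ≤ M) (hgb : ∃ M : ℝ, ∀ p, ‖g p‖ ≤ M) :
    ∃ M L, IsTameField M L f ∧ IsTameField M L g := by
  obtain ⟨Mf, hMf⟩ := hfb
  obtain ⟨Mg, hMg⟩ := hgb
  have key : ∀ f : F × F → F, ContDiff ℝ 1 f → ∀ R, ∃ K, LipschitzOnWith K f
      (Metric.closedBall 0 R) := fun f hf R =>
    hf.contDiffOn.exists_lipschitzOnWith one_ne_zero (convex_closedBall _ _)
      (isCompact_closedBall _ _)
  choose Lf hLf using key f hf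
  choose Lg hLg using key g hg
  refine ⟨(max Mf Mg).toNNReal, fun R => max (Lf R) (Lg R),
    ⟨hf.continuous, fun p => ((hMf p).trans (le_max_left _ _)).trans (Real.le_coe_toNNReal _),
      fun R => (hLf R).weaken (le_max_left _ _)⟩,
    ⟨hg.continuous, fun p => ((hMg p).trans (le_max_right _ _)).trans (Real.le_coe_toNNReal _),
      fun R => (hLg R).weaken (le_max_right _ _)⟩⟩

theorem mem_Icc_cases {h : ℝ} (hh : 0 < h) {N : ℕ} {t : ℝ} (ht : t ∈ Icc (-h) (N * h)) :
    t ∈ Ico (-h) 0 ∨ t = 0 ∨ t = N * h ∨ (∃ i < N, 0 < i ∧ t = i * h) ∨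
      ∃ i < N, t ∈ Ioo ((i : ℝ) * h) (i * h + h) := by
  rcases lt_trichotomy t 0 with h0 | h0 | h0
  · exact Or.inl ⟨ht.1, h0⟩
  · exact Or.inr (Or.inl h0)
  rcases ht.2.eq_or_lt with hT | hT
  · exact Or.inr (Or.inr (Or.inl hT))
  have hle : (⌊t / h⌋₊ : ℝ) * h ≤ t := (le_div_iff₀ hh).1 (Nat.floor_le (by positivity))
  have hlt : t < (⌊t / h⌋₊ : ℝ) * h + h := by
    have := (div_lt_iff₀ hh).1 (Nat.lt_floor_add_one (t / h))
    linarith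
  have hN : ⌊t / h⌋₊ < N := by
    have : (⌊t / h⌋₊ : ℝ) < N := lt_of_mul_lt_mul_right (hle.trans_lt hT) hh.le
    exact_mod_cast this
  rcases hle.eq_or_lt with he | he
  · refine Or.inr (Or.inr (Or.inr (Or.inl ⟨_, hN, ?_, he.symm⟩)))
    rcases Nat.eq_zero_or_pos ⌊t / h⌋₊ with h1 | h1
    · rw [h1] at he; simp at he; linarith
    · exact h1
  · exact Or.inr (Or.inr (Or.inr (Or.inr ⟨_, hN, he, hlt⟩)))

/-! ### Impulsive controls as data for a single step. -/

section Control

variable {h T : ℝ} {N : ℕ} {μ : Measure ℝ} {w : ℕ → ℝ → ℝ → ℝ≥0}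

/-- For `r = 0` and `r = h` the endpoint condition expresses the mass at the grid point as a sum
containing this term, so it yields only an inequality. -/
theorem IsImpulsiveControl.lintegral_le (hc : IsImpulsiveControl h T N μ w) {i : ℕ} (hi : i < N)
    {r : ℝ} (hr : r ∈ Icc 0 h) : ∫⁻ s in Icc (0 : ℝ) 1, (w (i + 1) r s : ℝ≥0∞) ≤ μ univ := by
  rcases hr.1.eq_or_lt with rfl | h0
  · have h1 := hc.endpoint i hi.le
    rw [if_neg hi.ne] at h1
    exact (le_add_self.trans_eq h1).trans (measure_mono (subset_univ _))
  rcases hr.2.eq_or_lt with rfl | h1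
  · have h1 := hc.endpoint (i + 1) hi
    rw [if_neg (Nat.succ_ne_zero i)] at h1
    exact (le_self_add.trans_eq h1).trans (measure_mono (subset_univ _))
  · rw [hc.interior r ⟨h0, h1⟩ i hi]
    exact measure_mono (subset_univ _)

variable {E : Type*} [NormedAddCommGroup E]

/-- The family `η` of arcs is measurable and uniformly bounded. -/
def IsArcInput (h : ℝ) (η : ℝ → ℝ → E) : Prop :=
  ∃ R : ℝ, ∀ r ∈ Icc 0 h, AEStronglyMeasurable (η r) (volume.restrict (Icc 0 1)) ∧
    ∀ s ∈ Icc (0 : ℝ) 1, ‖η r s‖ ≤ R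

theorem IsImpulsiveControl.exists_stepData (hc : IsImpulsiveControl h T N μ w) {i : ℕ} (hi : i < N)
    {η : ℝ → ℝ → E} (hη : IsArcInput h η) {y : ℝ → E}
    (hy : ∀ σ : Measure ℝ, AEStronglyMeasurable y (σ.restrict (Ioo (i * h) (i * h + h))))
    (hyb : ∃ R, ∀ t ∈ Ioo (i * h) (i * h + h), ‖y t‖ ≤ R) :
    ∃ m R, IsStepData h (i * h) μ (w (i + 1)) η y m R := by
  have := hc.finite
  obtain ⟨R₁, hR₁⟩ := hη
  obtain ⟨R₂, hR₂⟩ := hyb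
  refine ⟨(μ univ).toNNReal, max R₁ R₂, fun r hr => ⟨hc.measurable r hr i hi, ?_, (hR₁ r hr).1,
    fun s hs => ((hR₁ r hr).2 s hs).trans (le_max_left _ _)⟩, fun r hr => hc.interior r hr i hi,
    hy, fun t ht => (hR₂ t ht).trans (le_max_right _ _)⟩
  rw [ENNReal.coe_toNNReal (measure_ne_top _ _)]
  exact hc.lintegral_le hi hr

theorem isArcInput_initial (h : ℝ) (x₀ ξ₀ : E) {η : ℝ → ℝ → E}
    (hη : ∀ r ∈ Icc 0 h, ∀ s ∈ Icc (0 : ℝ) 1, η r s = if s = 1 ∧ r = h then x₀ else ξ₀) :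
    IsArcInput h η := by
  refine ⟨max ‖x₀‖ ‖ξ₀‖, fun r hr => ⟨?_, fun s hs => ?_⟩⟩
  · refine (aestronglyMeasurable_const (b := ξ₀)).congr ?_
    have h1 : ∀ᵐ s : ℝ, s ≠ 1 := by simp [ae_iff]
    filter_upwards [ae_restrict_mem measurableSet_Icc, ae_restrict_of_ae h1] with s hs hs1
    rw [hη r hr s hs, if_neg (fun hh => hs1 hh.1)]
  · rw [hη r hr s hs]
    split_ifs
    · exact le_max_left _ _
    · exact le_max_right _ _

variable [NormedSpace ℝ E] [CompleteSpace E] {f g : E × E → E} {M : ℝ≥0} {L : ℝ → ℝ≥0}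

theorem IsStep.isArcInput (hc : IsImpulsiveControl h T N μ w) {i : ℕ} (hh : 0 < h)
    (hf : IsTameField M L f) (hg : IsTameField M L g) {η z : ℝ → ℝ → E} {x y : ℝ → E} {m : ℝ≥0}
    {R : ℝ} (hd : IsStepData h (i * h) μ (w (i + 1)) η y m R)
    (hs : IsStep h (i * h) f g μ (w (i + 1)) η y x z)
    (hx : ∀ σ : Measure ℝ, AEStronglyMeasurable x (σ.restrict (Ioo (i * h) (i * h + h)))) :
    IsArcInput h z := by
  have := hc.finite
  obtain ⟨B, A, -, hB, -⟩ := hs.exists_bounds hh hd hf hg hx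
  exact ⟨B, fun r hr => ⟨(hs.arc r hr).aestronglyMeasurable, hB r hr⟩⟩

end Control

/-! ### Induction over the delay intervals and gluing. -/

section Trajectories

variable {n : ℕ} {h : ℝ} {N : ℕ}
  {f g : EuclideanSpace ℝ (Fin n) × EuclideanSpace ℝ (Fin n) → EuclideanSpace ℝ (Fin n)}
  {x₀ ξ₀ : EuclideanSpace ℝ (Fin n)} {x x' : ℝ → EuclideanSpace ℝ (Fin n)}
  {ζ ζ' : ℕ → ℝ → ℝ → EuclideanSpace ℝ (Fin n)}
  {μ : Measure ℝ} {w : ℕ → ℝ → ℝ → ℝ≥0} {M : ℝ≥0} {L : ℝ → ℝ≥0}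

/-- `x` is an extended trajectory with jump arcs `ζ`, in terms of the equations on the successive
intervals of length `h`. -/
structure IsTrajectory (h : ℝ) (N : ℕ)
    (f g : EuclideanSpace ℝ (Fin n) × EuclideanSpace ℝ (Fin n) → EuclideanSpace ℝ (Fin n))
    (x₀ ξ₀ : EuclideanSpace ℝ (Fin n)) (μ : Measure ℝ) (w : ℕ → ℝ → ℝ → ℝ≥0)
    (x : ℝ → EuclideanSpace ℝ (Fin n)) (ζ : ℕ → ℝ → ℝ → EuclideanSpace ℝ (Fin n)) : Prop where
  history : ∀ t ∈ Ico (-h) 0, x t = ξ₀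
  arcs_zero : ∀ r ∈ Icc 0 h, ∀ s ∈ Icc (0 : ℝ) 1, ζ 0 r s = if s = 1 ∧ r = h then x₀ else ξ₀
  init : x 0 = x₀
  grid : ∀ i < N, 0 < i → x (i * h) = ζ (i + 1) 0 1
  last : x (N * h) = ζ N h 1
  step : ∀ i < N, IsStep h (i * h) f g μ (w (i + 1)) (ζ i) (fun t => x (t - h)) x (ζ (i + 1))

theorem isExtendedProcess_iff {T : ℝ} (hT : T = N * h) :
    IsExtendedProcess h T N f g x₀ ξ₀ x μ w ↔ IsImpulsiveControl h T N μ w ∧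
      BoundedVariationOn x (Icc (-h) T) ∧ ∃ ζ, IsTrajectory h N f g x₀ ξ₀ μ w x ζ := by
  have hb : ∀ i : ℕ, ((i : ℝ) + 1) * h = i * h + h := fun i => by ring
  constructor
  · rintro ⟨hc, hbv, hhist, ζ, hζ, h0, hgrid, heq, hlast⟩
    refine ⟨hc, hbv, ζ, hhist, hζ.zero_eq, h0, hgrid, hT ▸ hlast, fun i hi => ?_⟩
    simp only [hb] at heq
    exact ⟨fun r hr => ⟨hζ.absCont i hi r hr, hζ.ode i hi r hr⟩, hζ.init_zero i hi,
      hζ.init_pos i hi, fun t ht => (heq i hi t ht).1, fun t ht => (heq i hi t ht).2⟩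
  · rintro ⟨hc, hbv, ζ, ht⟩
    refine ⟨hc, hbv, ht.history, ζ, ⟨ht.arcs_zero,
      fun i hi r hr => ((ht.step i hi).arc r hr).absCont,
      fun i hi r hr => ((ht.step i hi).arc r hr).ode, fun i hi => (ht.step i hi).init_pos,
      fun i hi => (ht.step i hi).init_zero⟩, ht.init, ht.grid, fun i hi t htt => ?_, hT ▸ ht.last⟩
    rw [hb] at htt
    exact ⟨(ht.step i hi).summable t htt, (ht.step i hi).eq t htt⟩

theorem sub_mem_Ioo_zero {t : ℝ} (ht : t ∈ Ioo (((0 : ℕ) : ℝ) * h) ((0 : ℕ) * h + h)) :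
    t - h ∈ Ico (-h) 0 := by
  simp only [Nat.cast_zero, zero_mul, zero_add] at ht
  exact ⟨by linarith [ht.1], by linarith [ht.2]⟩

theorem sub_mem_Ioo_succ {i : ℕ} {t : ℝ}
    (ht : t ∈ Ioo (((i + 1 : ℕ) : ℝ) * h) ((i + 1 : ℕ) * h + h)) :
    t - h ∈ Ioo ((i : ℝ) * h) (i * h + h) := by
  push_cast at ht
  exact ⟨by linarith [ht.1], by linarith [ht.2]⟩

theorem Ioo_step_subset (hh : 0 < h) {i : ℕ} (hi : i < N) :
    Ioo ((i : ℝ) * h) (i * h + h) ⊆ Icc (-h) (N * h) := by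
  intro t ht
  have h1 : (i : ℝ) + 1 ≤ N := by exact_mod_cast hi
  have h2 : (0 : ℝ) ≤ i * h := by positivity
  have h3 := mul_le_mul_of_nonneg_right h1 hh.le
  exact ⟨by linarith [ht.1], by linarith [ht.2]⟩

theorem sub_mem_of_mem_step (hh : 0 < h) {i : ℕ} (hi : i < N) {t : ℝ}
    (ht : t ∈ Ioo ((i : ℝ) * h) (i * h + h)) : t - h ∈ Icc (-h) (N * h) := by
  have h1 := Ioo_step_subset hh hi ht
  have h2 : (0 : ℝ) ≤ i * h := by positivity
  exact ⟨by linarith [ht.1], by linarith [h1.2]⟩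

theorem IsTrajectory.unique (hh : 0 < h) {T : ℝ} (hc : IsImpulsiveControl h T N μ w)
    (hf : IsTameField M L f) (hg : IsTameField M L g)
    (ht : IsTrajectory h N f g x₀ ξ₀ μ w x ζ) (ht' : IsTrajectory h N f g x₀ ξ₀ μ w x' ζ')
    (hx : BoundedVariationOn x (Icc (-h) (N * h)))
    (hx' : BoundedVariationOn x' (Icc (-h) (N * h))) : EqOn x x' (Icc (-h) (N * h)) := by
  have := hc.finite
  have hle : -h ≤ N * h := by have : (0 : ℝ) ≤ N * h := by positivity
                              linarith
  have hmeas : ∀ {x : ℝ → EuclideanSpace ℝ (Fin n)}, BoundedVariationOn x (Icc (-h) (N * h)) →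
      ∀ i < N, ∀ σ : Measure ℝ,
        AEStronglyMeasurable x (σ.restrict (Ioo (i * h) (i * h + h))) ∧
        AEStronglyMeasurable (fun t => x (t - h)) (σ.restrict (Ioo (i * h) (i * h + h))) := by
    intro x hx i hi σ
    obtain ⟨v, hv, hxv⟩ := exists_stronglyMeasurable_of_boundedVariationOn hle hx
    constructor
    · refine hv.aestronglyMeasurable.congr ?_
      filter_upwards [ae_restrict_mem measurableSet_Ioo] with t ht
      exact (hxv (Ioo_step_subset hh hi ht)).symm
    · refine (hv.comp_measurable (measurable_id.sub_const h)).aestronglyMeasurable.congr ?_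
      filter_upwards [ae_restrict_mem measurableSet_Ioo] with t ht
      exact (hxv (sub_mem_of_mem_step hh hi ht)).symm
  obtain ⟨Rx, hRx⟩ := exists_norm_le_of_boundedVariationOn hle hx
  have hζ0 : ∀ r ∈ Icc 0 h, EqOn (ζ 0 r) (ζ' 0 r) (Icc 0 1) := fun r hr s hs => by
    rw [ht.arcs_zero r hr s hs, ht'.arcs_zero r hr s hs]
  -- Admissibility of the arcs `ζ i` is carried along, since they are the delayed input of the next
  -- step.
  have key : ∀ i ≤ N, (∀ j < i, EqOn x x' (Ioo (j * h) (j * h + h))) ∧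
      (∀ j ≤ i, ∀ r ∈ Icc 0 h, EqOn (ζ j r) (ζ' j r) (Icc 0 1)) ∧ IsArcInput h (ζ i) := by
    intro i
    induction i with
    | zero =>
      intro _
      refine ⟨fun j hj => absurd hj (Nat.not_lt_zero j), fun j hj => ?_,
        isArcInput_initial h x₀ ξ₀ ht.arcs_zero⟩
      rw [Nat.le_zero.1 hj]
      exact hζ0
    | succ i ih =>
      intro hi
      obtain ⟨hxx, hζζ, hin⟩ := ih (Nat.le_of_succ_le hi)
      have hdelay : EqOn (fun t => x' (t - h)) (fun t => x (t - h)) (Ioo (i * h) (i * h + h)) := by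
        intro t htt
        cases i with
        | zero =>
          have hm := sub_mem_Ioo_zero htt
          simp only [ht.history _ hm, ht'.history _ hm]
        | succ j => exact (hxx j (Nat.lt_succ_self j) (sub_mem_Ioo_succ htt)).symm
      obtain ⟨m, R, hd⟩ := hc.exists_stepData hi hin (fun σ => (hmeas hx i hi σ).2)
        ⟨Rx, fun t htt => hRx _ (sub_mem_of_mem_step hh hi htt)⟩
      have hs := ht.step i hi
      have hs' := (ht'.step i hi).congr_inputs hh hdelay
        (fun r hr => (hζζ i le_rfl r hr).symm)
      obtain ⟨h1, h2⟩ := hs.unique hh hs' hd hf hg (fun σ => (hmeas hx i hi σ).1)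
        (fun σ => (hmeas hx' i hi σ).1)
      refine ⟨fun j hj => ?_, fun j hj => ?_,
        hs.isArcInput hc hh hf hg hd (fun σ => (hmeas hx i hi σ).1)⟩
      · rcases Nat.lt_succ_iff_lt_or_eq.1 hj with hj | rfl
        · exact hxx j hj
        · exact h1
      · rcases Nat.le_succ_iff.1 hj with hj | rfl
        · exact hζζ j hj
        · exact h2
  obtain ⟨hxx, hζζ, -⟩ := key N le_rfl
  have h1 : (1 : ℝ) ∈ Icc (0 : ℝ) 1 := right_mem_Icc.2 zero_le_one
  intro t htt
  rcases mem_Icc_cases hh htt with h0 | rfl | rfl | ⟨i, hi, hi0, rfl⟩ | ⟨i, hi, hti⟩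
  · rw [ht.history t h0, ht'.history t h0]
  · rw [ht.init, ht'.init]
  · rw [ht.last, ht'.last, hζζ N le_rfl h (right_mem_Icc.2 hh.le) h1]
  · rw [ht.grid i hi hi0, ht'.grid i hi hi0, hζζ (i + 1) hi 0 (left_mem_Icc.2 hh.le) h1]
  · exact hxx i hi hti

/-- The trajectory glued from its pieces `X (i + 1)` on `(ih, (i + 1)h)`. -/
noncomputable def glue (h : ℝ) (N : ℕ) (x₀ ξ₀ : EuclideanSpace ℝ (Fin n))
    (X : ℕ → ℝ → EuclideanSpace ℝ (Fin n)) (ζ : ℕ → ℝ → ℝ → EuclideanSpace ℝ (Fin n)) (t : ℝ) :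
    EuclideanSpace ℝ (Fin n) :=
  if t < 0 then ξ₀ else if t = 0 then x₀ else if t = N * h then ζ N h 1 else
    if t = ⌊t / h⌋₊ * h then ζ (⌊t / h⌋₊ + 1) 0 1 else X (⌊t / h⌋₊ + 1) t

variable {X : ℕ → ℝ → EuclideanSpace ℝ (Fin n)}

theorem glue_of_neg {t : ℝ} (ht : t < 0) : glue h N x₀ ξ₀ X ζ t = ξ₀ := if_pos ht

theorem glue_zero : glue h N x₀ ξ₀ X ζ 0 = x₀ := by simp [glue]

theorem glue_last (hh : 0 < h) (hN : 0 < N) : glue h N x₀ ξ₀ X ζ (N * h) = ζ N h 1 := by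
  have : (0 : ℝ) < N * h := by positivity
  rw [glue, if_neg this.not_gt, if_neg this.ne', if_pos rfl]

theorem glue_grid (hh : 0 < h) {i : ℕ} (hi : i < N) (hi0 : 0 < i) :
    glue h N x₀ ξ₀ X ζ (i * h) = ζ (i + 1) 0 1 := by
  have h0 : (0 : ℝ) < i * h := by positivity
  have h1 : (i : ℝ) * h ≠ N * h := by
    have : (i : ℝ) < N := by exact_mod_cast hi
    exact (mul_lt_mul_of_pos_right this hh).ne
  rw [glue, if_neg h0.not_gt, if_neg h0.ne', if_neg h1, mul_div_cancel_right₀ _ hh.ne',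
    Nat.floor_natCast, if_pos rfl]

theorem glue_step (hh : 0 < h) {i : ℕ} (hi : i < N) {t : ℝ}
    (ht : t ∈ Ioo ((i : ℝ) * h) (i * h + h)) : glue h N x₀ ξ₀ X ζ t = X (i + 1) t := by
  have h2 : (0 : ℝ) ≤ i * h := by positivity
  have h0 : 0 < t := h2.trans_lt ht.1
  have h1 : (i : ℝ) + 1 ≤ N := by exact_mod_cast hi
  have h3 := mul_le_mul_of_nonneg_right h1 hh.le
  have hfl : ⌊t / h⌋₊ = i := by
    rw [Nat.floor_eq_iff (by positivity), le_div_iff₀ hh, div_lt_iff₀ hh]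
    exact ⟨ht.1.le, by linarith [ht.2]⟩
  rw [glue, if_neg h0.not_gt, if_neg h0.ne', if_neg (by intro h4; linarith [ht.2]), hfl,
    if_neg ht.1.ne']

theorem boundedVariationOn_of_steps (hh : 0 < h) (hN : 0 < N) {A : ℕ → ℝ → ℝ} {R : ℝ}
    (hA : ∀ i < N, Monotone (A i)) (hneg : ∀ t ∈ Ico (-h) 0, x t = ξ₀)
    (hR : ∀ t ∈ Icc (-h) (N * h), ‖x t‖ ≤ R)
    (hd : ∀ i < N, ∀ s ∈ Ioo ((i : ℝ) * h) (i * h + h), ∀ t ∈ Ioo ((i : ℝ) * h) (i * h + h),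
      s ≤ t → dist (x s) (x t) ≤ A i t - A i s) :
    BoundedVariationOn x (Icc (-h) (N * h)) := by
  have hR0 : 0 ≤ R := (norm_nonneg _).trans (hR (-h) ⟨le_rfl, by
    have : (0 : ℝ) ≤ N * h := by positivity
    linarith⟩)
  have hAm : Monotone fun t => ∑ i ∈ Finset.range N, A i t := fun s t hst =>
    Finset.sum_le_sum fun i hi => hA i (Finset.mem_range.1 hi) hst
  have hfloor : Monotone fun t : ℝ => ⌊t / h⌋ := fun s t hst =>
    Int.floor_le_floor (div_le_div_of_nonneg_right hst hh.le)
  have hceil : Monotone fun t : ℝ => ⌈t / h⌉ := fun s t hst =>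
    Int.ceil_le_ceil (div_le_div_of_nonneg_right hst hh.le)
  refine boundedVariationOn_of_dist_le
    -- The floor increases on reaching a grid point and the ceiling on leaving it. For `s < t` the
    -- sum of the two is unchanged only if both lie in the same open grid interval; otherwise it
    -- grows by at least one, which pays for any jump of size `2R`.
    (V := fun t => (∑ i ∈ Finset.range N, A i t) + 2 * R * ((⌊t / h⌋ + ⌈t / h⌉ : ℤ) : ℝ)) ?_ ?_
  · intro s t hst
    have h1 : ⌊s / h⌋ + ⌈s / h⌉ ≤ ⌊t / h⌋ + ⌈t / h⌉ := add_le_add (hfloor hst) (hceil hst)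
    have h2 : ((⌊s / h⌋ + ⌈s / h⌉ : ℤ) : ℝ) ≤ ((⌊t / h⌋ + ⌈t / h⌉ : ℤ) : ℝ) := by exact_mod_cast h1
    have h3 := hAm hst
    simp only at h3 ⊢
    gcongr
  · intro s hs t ht hst
    have hAst := hAm hst
    simp only at hAst
    rcases hst.eq_or_lt with rfl | hlt
    · simp
    have h1 : ⌊s / h⌋ ≤ ⌊t / h⌋ := hfloor hst
    have h2 : ⌈s / h⌉ ≤ ⌈t / h⌉ := hceil hst
    by_cases heq : ⌊s / h⌋ + ⌈s / h⌉ = ⌊t / h⌋ + ⌈t / h⌉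
    · have hf : ⌊s / h⌋ = ⌊t / h⌋ := by omega
      have hc : ⌈s / h⌉ = ⌈t / h⌉ := by omega
      have hs1 : (⌊s / h⌋ : ℝ) * h < s := by
        rcases ((le_div_iff₀ hh).1 (Int.floor_le (s / h))).eq_or_lt with h3 | h3
        · exfalso
          have h4 : s / h = (⌊s / h⌋ : ℝ) := by rw [eq_comm, eq_div_iff hh.ne', h3]
          have h5 : ⌈t / h⌉ = ⌊s / h⌋ := by rw [← hc, h4, Int.ceil_intCast, Int.floor_intCast]
          have h6 := (div_le_iff₀ hh).1 (Int.le_ceil (t / h))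
          rw [h5, h3] at h6
          linarith
        · exact h3
      have ht1 : t < (⌊s / h⌋ : ℝ) * h + h := by
        have := (div_lt_iff₀ hh).1 (Int.lt_floor_add_one (t / h))
        rw [← hf] at this
        linarith
      rw [heq, add_sub_add_right_eq_sub]
      rcases lt_or_ge ⌊s / h⌋ 0 with hk | hk
      · have hk' : (⌊s / h⌋ : ℝ) ≤ -1 := by exact_mod_cast (by omega : ⌊s / h⌋ ≤ -1)
        have ht0 : t < 0 := by nlinarith
        rw [hneg s ⟨hs.1, hlt.trans ht0⟩, hneg t ⟨ht.1, ht0⟩, dist_self]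
        linarith
      · obtain ⟨i, hi⟩ := Int.eq_ofNat_of_zero_le hk
        rw [hi, Int.cast_natCast] at hs1 ht1
        have hiN : i < N := by
          have : (i : ℝ) < N := lt_of_mul_lt_mul_right (hs1.trans_le hs.2) hh.le
          exact_mod_cast this
        refine (hd i hiN s ⟨hs1, hlt.trans ht1⟩ t ⟨hs1.trans hlt, ht1⟩ hst).trans ?_
        rw [← Finset.sum_sub_distrib]
        exact Finset.single_le_sum (f := fun i => A i t - A i s)
          (fun j hj => sub_nonneg.2 (hA j (Finset.mem_range.1 hj) hst)) (Finset.mem_range.2 hiN)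
    · have h3 : ⌊s / h⌋ + ⌈s / h⌉ + 1 ≤ ⌊t / h⌋ + ⌈t / h⌉ := by omega
      have h4 : ((⌊s / h⌋ + ⌈s / h⌉ : ℤ) : ℝ) + 1 ≤ ((⌊t / h⌋ + ⌈t / h⌉ : ℤ) : ℝ) := by
        exact_mod_cast h3
      have h5 : dist (x s) (x t) ≤ R + R := by
        rw [dist_eq_norm]
        exact (norm_sub_le _ _).trans (add_le_add (hR s hs) (hR t ht))
      nlinarith

theorem exists_trajectory (hh : 0 < h) (hN : 0 < N) {T : ℝ} (hc : IsImpulsiveControl h T N μ w)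
    (hf : IsTameField M L f) (hg : IsTameField M L g) (x₀ ξ₀ : EuclideanSpace ℝ (Fin n)) :
    ∃ x ζ, BoundedVariationOn x (Icc (-h) (N * h)) ∧ IsTrajectory h N f g x₀ ξ₀ μ w x ζ := by
  have := hc.finite
  let S := (ℝ → EuclideanSpace ℝ (Fin n)) × (ℝ → ℝ → EuclideanSpace ℝ (Fin n))
  let Good : ℕ → S → Prop := fun i s => StronglyMeasurable s.1 ∧
    (∃ R, ∀ t ∈ Ioo ((i : ℝ) * h) (i * h + h), ‖s.1 (t - h)‖ ≤ R) ∧ IsArcInput h s.2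
  let Next : ℕ → S → S → Prop := fun i s s' =>
    IsStep h (i * h) f g μ (w (i + 1)) s.2 (fun t => s.1 (t - h)) s'.1 s'.2 ∧
    (∀ t, Tendsto s'.1 (𝓝[<] t) (𝓝 (Function.leftLim s'.1 t))) ∧
    ∃ (B : ℝ) (A : ℝ → ℝ), (∀ t ∈ Ioo ((i : ℝ) * h) (i * h + h), ‖s'.1 t‖ ≤ B) ∧
      (∀ r ∈ Icc 0 h, ∀ s ∈ Icc (0 : ℝ) 1, ‖s'.2 r s‖ ≤ B) ∧ Monotone A ∧
      ∀ s ∈ Ioo ((i : ℝ) * h) (i * h + h), ∀ t ∈ Ioo ((i : ℝ) * h) (i * h + h), s ≤ t →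
        dist (s'.1 s) (s'.1 t) ≤ A t - A s
  -- The implication sits inside the existential so that the successor is defined for all states and
  -- can be iterated by plain recursion.
  have hnext : ∀ i s, ∃ s', Good i s → i < N → Good (i + 1) s' ∧ Next i s s' := by
    intro i s
    by_cases hgood : Good i s ∧ i < N
    · obtain ⟨⟨hm, hR, hin⟩, hi⟩ := hgood
      obtain ⟨m, R, hd⟩ := hc.exists_stepData hi hin (y := fun t => s.1 (t - h))
        (fun σ => (hm.comp_measurable (measurable_id.sub_const h)).aestronglyMeasurable) hR
      obtain ⟨x, z, hx, hlim, hs⟩ := hd.exists_step hh hf hg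
      obtain ⟨B, A, hB⟩ := hs.exists_bounds hh hd hf hg (fun σ => hx.aestronglyMeasurable)
      refine ⟨(x, z), fun _ _ => ⟨⟨hx, ⟨B, fun t ht => hB.1 _ (sub_mem_Ioo_succ ht)⟩,
        hs.isArcInput hc hh hf hg hd fun σ => hx.aestronglyMeasurable⟩, hs, hlim, B, A, hB⟩⟩
    · exact ⟨s, fun h1 h2 => absurd ⟨h1, h2⟩ hgood⟩
  choose nxt hnxt using hnext
  let s₀ : S := (fun _ => ξ₀, fun r s => if s = 1 ∧ r = h then x₀ else ξ₀)
  let seq : ℕ → S := fun i => Nat.rec s₀ (fun i s => nxt i s) i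
  have hgood : ∀ i ≤ N, Good i (seq i) := by
    intro i
    induction i with
    | zero =>
      intro _
      exact ⟨stronglyMeasurable_const, ⟨‖ξ₀‖, fun _ _ => le_rfl⟩,
        isArcInput_initial h x₀ ξ₀ fun _ _ _ _ => rfl⟩
    | succ i ih => exact fun hi => (hnxt i (seq i) (ih (Nat.le_of_succ_le hi)) hi).1
  have hstep : ∀ i < N, Next i (seq i) (seq (i + 1)) := fun i hi =>
    (hnxt i (seq i) (hgood i hi.le) hi).2
  have hB : ∀ i, ∃ (B : ℝ) (A : ℝ → ℝ), i < N →
      (∀ t ∈ Ioo ((i : ℝ) * h) (i * h + h), ‖(seq (i + 1)).1 t‖ ≤ B) ∧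
      (∀ r ∈ Icc 0 h, ∀ s ∈ Icc (0 : ℝ) 1, ‖(seq (i + 1)).2 r s‖ ≤ B) ∧ Monotone A ∧
      ∀ s ∈ Ioo ((i : ℝ) * h) (i * h + h), ∀ t ∈ Ioo ((i : ℝ) * h) (i * h + h), s ≤ t →
        dist ((seq (i + 1)).1 s) ((seq (i + 1)).1 t) ≤ A t - A s := fun i => by
    by_cases hi : i < N
    · obtain ⟨B, A, hBA⟩ := (hstep i hi).2.2
      exact ⟨B, A, fun _ => hBA⟩
    · exact ⟨0, 0, fun hi' => absurd hi' hi⟩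
  choose B A hBA using hB
  set X : ℕ → ℝ → EuclideanSpace ℝ (Fin n) := fun i => (seq i).1
  set ζ : ℕ → ℝ → ℝ → EuclideanSpace ℝ (Fin n) := fun i => (seq i).2
  set x := glue h N x₀ ξ₀ X ζ
  have h01 : (1 : ℝ) ∈ Icc (0 : ℝ) 1 := right_mem_Icc.2 zero_le_one
  have hB0 : ∀ i ∈ Finset.range N, 0 ≤ B i := fun i hi =>
    (norm_nonneg _).trans ((hBA i (Finset.mem_range.1 hi)).2.1 0 (left_mem_Icc.2 hh.le) 1 h01)
  have hBle : ∀ i < N, B i ≤ ∑ i ∈ Finset.range N, B i := fun i hi =>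
    Finset.single_le_sum hB0 (Finset.mem_range.2 hi)
  have hxX : ∀ i < N, EqOn (X (i + 1)) x (Ioo (i * h) (i * h + h)) := fun i hi t ht =>
    (glue_step hh hi ht).symm
  refine ⟨x, ζ, ?_, fun t ht => glue_of_neg ht.2, fun _ _ _ _ => rfl, glue_zero,
    fun i hi hi0 => glue_grid hh hi hi0, glue_last hh hN, fun i hi => ?_⟩
  · refine boundedVariationOn_of_steps (ξ₀ := ξ₀) (A := A)
      (R := ‖x₀‖ + ‖ξ₀‖ + ∑ i ∈ Finset.range N, B i) hh hN
      (fun i hi => (hBA i hi).2.2.1) (fun t ht => glue_of_neg ht.2) (fun t ht => ?_)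
      (fun i hi s hs t ht hst => ?_)
    · have hsum := Finset.sum_nonneg hB0
      have h1 := norm_nonneg x₀
      have h2 := norm_nonneg ξ₀
      rcases mem_Icc_cases hh ht with h0 | rfl | rfl | ⟨i, hi, hi0, rfl⟩ | ⟨i, hi, hti⟩
      · rw [show x t = ξ₀ from glue_of_neg h0.2]; linarith
      · rw [show x 0 = x₀ from glue_zero]; linarith
      · obtain ⟨i, rfl⟩ := Nat.exists_eq_succ_of_ne_zero hN.ne'
        rw [show x _ = ζ (i + 1) h 1 from glue_last hh hN]
        have := (hBA i i.lt_succ_self).2.1 h (right_mem_Icc.2 hh.le) 1 h01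
        have := hBle i i.lt_succ_self
        linarith
      · rw [show x _ = ζ (i + 1) 0 1 from glue_grid hh hi hi0]
        have := (hBA i hi).2.1 0 (left_mem_Icc.2 hh.le) 1 h01
        have := hBle i hi
        linarith
      · rw [← hxX i hi hti]
        have := (hBA i hi).1 t hti
        have := hBle i hi
        linarith
    · rw [← hxX i hi hs, ← hxX i hi ht]
      exact (hBA i hi).2.2.2 s hs t ht hst
  -- Each piece was solved with its delay read from the preceding piece; by locality both may be
  -- replaced by the glued function.
  · refine ((hstep i hi).1.congr_trajectory (hxX i hi) (hstep i hi).2.1).congr_inputs hh ?_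
      fun _ _ _ _ => rfl
    intro t ht
    cases i with
    | zero => exact (glue_of_neg (sub_mem_Ioo_zero ht).2).symm
    | succ j => exact hxX j (Nat.lt_of_succ_lt hi) (sub_mem_Ioo_succ ht)

end Trajectories

end DIS

theorem proposition4p1 {n : ℕ} (h T : ℝ) (N : ℕ) (hh : 0 < h) (hN : 0 < N) (hT : T = N * h)
    (f g : EuclideanSpace ℝ (Fin n) × EuclideanSpace ℝ (Fin n) → EuclideanSpace ℝ (Fin n))
    (hf : ContDiff ℝ 1 f) (hg : ContDiff ℝ 1 g)
    (hfb : ∃ M : ℝ, ∀ p, ‖f p‖ ≤ M) (hgb : ∃ M : ℝ, ∀ p, ‖g p‖ ≤ M)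
    (x₀ ξ₀ : EuclideanSpace ℝ (Fin n))
    (μ : Measure ℝ) (w : ℕ → ℝ → ℝ → ℝ≥0) (hμw : DIS.IsImpulsiveControl h T N μ w) :
    (∃ x : ℝ → EuclideanSpace ℝ (Fin n), DIS.IsExtendedProcess h T N f g x₀ ξ₀ x μ w) ∧
    ∀ x y : ℝ → EuclideanSpace ℝ (Fin n),
      DIS.IsExtendedProcess h T N f g x₀ ξ₀ x μ w →
      DIS.IsExtendedProcess h T N f g x₀ ξ₀ y μ w →
      EqOn x y (Icc (-h) T) := by
  obtain ⟨M, L, hf', hg'⟩ := DIS.exists_isTameField hf hg hfb hgb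
  constructor
  · obtain ⟨x, ζ, hbv, hx⟩ := DIS.exists_trajectory hh hN hμw hf' hg' x₀ ξ₀
    exact ⟨x, (DIS.isExtendedProcess_iff hT).2 ⟨hμw, hT ▸ hbv, ζ, hx⟩⟩
  · intro x y hx hy
    obtain ⟨-, hbx, ζ, hx'⟩ := (DIS.isExtendedProcess_iff hT).1 hx
    obtain ⟨-, hby, ζ', hy'⟩ := (DIS.isExtendedProcess_iff hT).1 hy
    subst hT
    exact hx'.unique hh hμw hf' hg' hy' hbx hby
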